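/- Let $R=\{q_1,\dots,q_n\}$ ($n\ge 1$) and $B=\{p_1,\dots,p_m\}$ ($m\ge 0$) be disjoint sets of $n$ red and $m$ blue points in the Euclidean plane, and let $\mathcal P:R\cup B\to\mathbb R_{>0}$ assign a positive penalty to every point. A circular annulus $\mathcal A$ is the closed region $\{p : r\le |pc|\le r'\}$ between two concentric circles with center $c$ and radii $0<r<r'$; it covers the points in this region. Its penalty is $$\lambda(\mathcal A)=\sum_{q\in R\setminus\mathcal A}\mathcal P(q)+\sum_{p\in B\cap\mathcal A}\mathcal P(p).$$ Theorem (GRBCAC problem). There is an algorithm on the real RAM (unit-cost $+,-,\times,/,\sqrt{\ }$ and comparisons of real numbers, memory addressed by integer index registers) that, given $R$, $B$ and $\mathcal P$, computes the center and the two radii of a circular annulus whose penalty $\lambda$ is minimum among all circular annuli, in $O(n^2(m+n)^3)$ time and linear space, i.e. with $O(m+n)$ memory cells. The boundary of the reported optimal annulus passes through red points: at least one of its two circles contains a red point, and if $n\ge 2$ both circles do. -/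

import Mathlib

namespace RedBlueAnnulus

/-! ### The problem -/

/-- Points of the Euclidean plane. -/
abbrev Point := EuclideanSpace ℝ (Fin 2)

/-- A bichromatic point set with `n` red and `m` blue points (pairwise distinct, each point having
exactly one colour), each point carrying a positive penalty. -/
structure Input (n m : ℕ) where
  red : Fin n → Point
  blue : Fin m → Point
  redPenalty : Fin n → ℝ
  bluePenalty : Fin m → ℝ
  red_injective : Function.Injective red
  blue_injective : Function.Injective blue
  red_ne_blue : ∀ i j, red i ≠ blue j
  redPenalty_pos : ∀ i, 0 < redPenalty i
  bluePenalty_pos : ∀ j, 0 < bluePenalty j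

/-- A circular annulus: two concentric circles of different (positive) radii. -/
structure Annulus where
  center : Point
  rIn : ℝ
  rOut : ℝ
  rIn_pos : 0 < rIn
  rIn_lt_rOut : rIn < rOut

namespace Annulus

/-- The inner boundary circle. -/
def innerCircle (A : Annulus) : Set Point := Metric.sphere A.center A.rIn

/-- The outer boundary circle. -/
def outerCircle (A : Annulus) : Set Point := Metric.sphere A.center A.rOut

/-- The closed region between the two circles; a point is covered iff it lies in it. -/
def region (A : Annulus) : Set Point := {p | A.rIn ≤ dist p A.center ∧ dist p A.center ≤ A.rOut}

end Annulus

namespace Input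

variable {n m : ℕ}

open Classical in
/-- Penalties of the red points that are not covered plus penalties of the blue points that are
covered. -/
noncomputable def penalty (P : Input n m) (A : Annulus) : ℝ :=
  (∑ i with P.red i ∉ A.region, P.redPenalty i) + ∑ j with P.blue j ∈ A.region, P.bluePenalty j

/-- `A` has minimum penalty among all circular annuli. -/
def IsOptimal (P : Input n m) (A : Annulus) : Prop :=
  ∀ A' : Annulus, P.penalty A ≤ P.penalty A'

/-- The boundary of `A` passes through red points: some red point lies on one of the circles and,
as soon as there are two red points, each of the circles carries a red point. -/
def BoundaryRed (P : Input n m) (A : Annulus) : Prop :=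
  (∃ i, P.red i ∈ A.innerCircle ∪ A.outerCircle) ∧
    (2 ≤ n → (∃ i, P.red i ∈ A.innerCircle) ∧ ∃ i, P.red i ∈ A.outerCircle)

end Input

/-! ### The machine model: a real RAM with bounded memory -/

/-- Contents of a real RAM: index registers holding natural numbers, real registers, and a real
memory addressed by index registers. A program mentions only finitely many registers. -/
structure State where
  idx : ℕ → ℕ
  reg : ℕ → ℝ
  mem : ℕ → ℝ

namespace State

def setIdx (s : State) (a v : ℕ) : State := { s with idx := Function.update s.idx a v }

def setReg (s : State) (a : ℕ) (x : ℝ) : State := { s with reg := Function.update s.reg a x }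

def setMem (s : State) (a : ℕ) (x : ℝ) : State := { s with mem := Function.update s.mem a x }

end State

/-- Elementary instructions. The first operand of an `i…` or `r…` instruction is the number of the
target register, the other ones are constants or numbers of source registers. -/
inductive Instr
  | nop
  | iconst (a v : ℕ)
  | icopy (a b : ℕ)
  | iadd (a b c : ℕ)
  | isub (a b c : ℕ)
  | rconst (a : ℕ) (z : ℤ)
  | rcopy (a b : ℕ)
  | radd (a b c : ℕ)
  | rsub (a b c : ℕ)
  | rmul (a b c : ℕ)
  | rdiv (a b c : ℕ)
  | rsqrt (a b : ℕ)
  /-- Load into real register `a` the memory cell whose address is in index register `i`. -/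
  | load (a i : ℕ)
  /-- Store real register `a` in the memory cell whose address is in index register `i`. -/
  | store (i a : ℕ)

open Classical in
/-- One instruction on a machine with `S` memory cells (addresses `0, …, S - 1`), whose index
registers can only be given values up to `S`. The value `none` is a crash: index overflow, illegal
address, division by zero, square root of a negative number. Index subtraction is truncated. -/
noncomputable def Instr.step (S : ℕ) (s : State) : Instr → Option State
  | nop => some s
  | iconst a v => if v ≤ S then some (s.setIdx a v) else none
  | icopy a b => if s.idx b ≤ S then some (s.setIdx a (s.idx b)) else none
  | iadd a b c => if s.idx b + s.idx c ≤ S then some (s.setIdx a (s.idx b + s.idx c)) else none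
  | isub a b c => if s.idx b - s.idx c ≤ S then some (s.setIdx a (s.idx b - s.idx c)) else none
  | rconst a z => some (s.setReg a z)
  | rcopy a b => some (s.setReg a (s.reg b))
  | radd a b c => some (s.setReg a (s.reg b + s.reg c))
  | rsub a b c => some (s.setReg a (s.reg b - s.reg c))
  | rmul a b c => some (s.setReg a (s.reg b * s.reg c))
  | rdiv a b c => if s.reg c ≠ 0 then some (s.setReg a (s.reg b / s.reg c)) else none
  | rsqrt a b => if 0 ≤ s.reg b then some (s.setReg a (Real.sqrt (s.reg b))) else none
  | load a i => if s.idx i < S then some (s.setReg a (s.mem (s.idx i))) else none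
  | store i a => if s.idx i < S then some (s.setMem (s.idx i) (s.reg a)) else none

/-- Tests: comparison of two index registers, or of two real registers. -/
inductive Test
  | ilt (a b : ℕ)
  | rlt (a b : ℕ)

def Test.Holds (s : State) : Test → Prop
  | ilt a b => s.idx a < s.idx b
  | rlt a b => s.reg a < s.reg b

/-- Programs. -/
inductive Program
  | instr (i : Instr)
  | seq (p q : Program)
  | cond (b : Test) (p q : Program)
  | loop (b : Test) (p : Program)

/-- `Exec S p s t k`: on a machine with `S` memory cells, the program `p` started in state `s`
halts without a crash in state `t` after `k` steps. Every executed instruction and every evaluated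
test is one step; `loop b p` is `while b do p`. -/
inductive Exec (S : ℕ) : Program → State → State → ℕ → Prop
  | instr {i : Instr} {s t : State} (h : i.step S s = some t) : Exec S (.instr i) s t 1
  | seq {p q : Program} {s t u : State} {k l : ℕ} (hp : Exec S p s t k) (hq : Exec S q t u l) :
      Exec S (.seq p q) s u (k + l)
  | cond_true {b : Test} {p q : Program} {s t : State} {k : ℕ} (hb : b.Holds s)
      (hp : Exec S p s t k) : Exec S (.cond b p q) s t (k + 1)
  | cond_false {b : Test} {p q : Program} {s t : State} {k : ℕ} (hb : ¬ b.Holds s)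
      (hq : Exec S q s t k) : Exec S (.cond b p q) s t (k + 1)
  | loop_true {b : Test} {p : Program} {s t u : State} {k l : ℕ} (hb : b.Holds s)
      (hp : Exec S p s t k) (hl : Exec S (.loop b p) t u l) : Exec S (.loop b p) s u (k + l + 1)
  | loop_false {b : Test} {p : Program} {s : State} (hb : ¬ b.Holds s) : Exec S (.loop b p) s s 1

/-- The state `s` holds the input `P`: index registers `0` and `1` contain `n` and `m`; the first
`3 (n + m)` memory cells list, for the red and then for the blue points, the two coordinates and
the penalty. Everything else is arbitrary (uninitialised). -/
structure Loaded {n m : ℕ} (P : Input n m) (s : State) : Prop where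
  numRed : s.idx 0 = n
  numBlue : s.idx 1 = m
  red : ∀ i : Fin n, s.mem (3 * i) = P.red i 0 ∧ s.mem (3 * i + 1) = P.red i 1 ∧
    s.mem (3 * i + 2) = P.redPenalty i
  blue : ∀ j : Fin m, s.mem (3 * (n + j)) = P.blue j 0 ∧ s.mem (3 * (n + j) + 1) = P.blue j 1 ∧
    s.mem (3 * (n + j) + 2) = P.bluePenalty j

/-- The state `t` reports the annulus `A`: real registers `0`, `1`, `2`, `3` contain the two
coordinates of the center, the inner radius and the outer radius. -/
structure Reports (t : State) (A : Annulus) : Prop where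
  centerX : t.reg 0 = A.center 0
  centerY : t.reg 1 = A.center 1
  rIn : t.reg 2 = A.rIn
  rOut : t.reg 3 = A.rOut

end RedBlueAnnulus

/-!
# Optimal circular annuli for red and blue points, on a real RAM

The algorithm is an exhaustive search over `O(n² (m + n)²)` candidate annuli, each of which is
computed and evaluated in time `O(m + n)`, reading the input and keeping everything else in
registers.

*Reduction to red boundaries.* With at least two red points, it suffices to consider annuli with a
red point `p` on the inner and a red point `q` on the outer circle
(`Input.exists_red_boundary`). An annulus covering red points at different distances from its
center is shrunk. If all covered red points are equidistant from the center, the center is moved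
slightly to separate two of them; and an annulus covering at most one red point is beaten by a thin
ring around a circle through two red points and no blue point (`exists_annulus_of_two_red`,
`exists_equidistant_avoiding`).

*Reduction to an arrangement of lines.* For fixed `p` and `q` the annulus is determined by its
center, and which points it covers depends only on the face of the center in the arrangement of
the bisectors of `p` or `q` with the input points (`listPenalty_congr`). Two more lines through `p`
make sure that the forbidden center `p` is a face of its own and that not all lines are parallel.

*Sampling.* An optimum need not be attained at a vertex of the arrangement, since covered blue
points on the boundary count, so every face needs a sample point. Any face is reached from a vertex
`Lᵢ ∩ Lⱼ` by a short step along `Lᵢ`, or none, and then a short step perpendicular to `Lᵢ`, or none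
(`Lines.exists_sign_sample`): given a point of the face, `Lᵢ` is the line nearest to it, and `Lⱼ` is
the line that meets `Lᵢ` nearest to the foot of the perpendicular. A step `d` from a point is short
enough if its length is scaled by `1 / (1 + ∑ₖ (ℓₖ'(d) / ℓₖ)²)`, the sum being over the lines
`ℓₖ = 0` that avoid the point; the sum takes linear time (`Lines.sign_move_of_ne`).

A single red point cannot lie on both circles. In this case a short step away from the point gives
the center of an annulus that covers only this point (`Cmd.exists_isolating_annulus`).

*The machine.* The program is written in a small language of real expressions (`Expr`, with total
division and square root, conditionals, and sums over an index variable) and commands (`Cmd`). The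
compilers are proved correct once, with time bounds (`Expr.runs_code`, `Cmd.runs_code`), so that the
search is verified on the level of the values of its variables (`Cmd.exists_optimal`).
-/

namespace RedBlueAnnulus

/-! ### Running programs with a time bound -/

/-- From the state `s`, the program `p` halts within `T` steps in a state satisfying `Q`. -/
def Runs (S : ℕ) (p : Program) (s : State) (Q : State → Prop) (T : ℕ) : Prop :=
  ∃ t k, Exec S p s t k ∧ k ≤ T ∧ Q t

namespace Runs

variable {S T T' : ℕ} {s t : State} {p p' : Program} {Q R : State → Prop}

theorem mono (h : Runs S p s Q T) (hT : T ≤ T') (hQ : ∀ t, Q t → R t) : Runs S p s R T' := by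
  obtain ⟨t, k, he, hk, hq⟩ := h
  exact ⟨t, k, he, hk.trans hT, hQ t hq⟩

theorem instr {i : Instr} (h : i.step S s = some t) (hQ : Q t) : Runs S (.instr i) s Q 1 :=
  ⟨t, 1, .instr h, le_rfl, hQ⟩

theorem seq (h : Runs S p s Q T) (h' : ∀ t, Q t → Runs S p' t R T') :
    Runs S (.seq p p') s R (T + T') := by
  obtain ⟨t, k, he, hk, hq⟩ := h
  obtain ⟨u, l, he', hl, hr⟩ := h' t hq
  exact ⟨u, k + l, .seq he he', by omega, hr⟩

theorem instr_seq {i : Instr} (h : i.step S s = some t) (h' : Runs S p t R T) :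
    Runs S (.seq (.instr i) p) s R (1 + T) :=
  seq (Q := fun u => u = t) (instr h rfl) (by rintro u rfl; exact h')

theorem cond {b : Test} (h : b.Holds s → Runs S p s Q T) (h' : ¬ b.Holds s → Runs S p' s Q T') :
    Runs S (.cond b p p') s Q (T + T' + 1) := by
  by_cases hb : b.Holds s
  · obtain ⟨t, k, he, hk, hq⟩ := h hb
    exact ⟨t, k + 1, .cond_true hb he, by omega, hq⟩
  · obtain ⟨t, k, he, hk, hq⟩ := h' hb
    exact ⟨t, k + 1, .cond_false hb he, by omega, hq⟩

end Runs

/-- The loop `for q = 0, …, b - 1 do body`, where `q` and `b` are numbers of index registers;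
register `q + 1` is used as scratch. -/
def forCode (q b : ℕ) (body : Program) : Program :=
  .seq (.instr (.iconst q 0)) (.loop (.ilt q b)
    (.seq body (.seq (.instr (.iconst (q + 1) 1)) (.instr (.iadd q q (q + 1))))))

/-- Invariant rule for counting loops. -/
theorem Runs.forCode {S T n q b : ℕ} {body : Program} {s : State} {I : ℕ → State → Prop}
    (hn : n ≤ S) (hS : 1 ≤ S) (h0 : I 0 (s.setIdx q 0))
    (hI : ∀ i t, I i t → t.idx q = i ∧ t.idx b = n)
    (hstep : ∀ i < n, ∀ t, I i t → Runs S body t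
      (fun u => u.idx q = i ∧ I (i + 1) ((u.setIdx (q + 1) 1).setIdx q (i + 1))) T) :
    Runs S (forCode q b body) s (I n) (2 + n * (T + 3)) := by
  have key : ∀ k i, i + k = n → ∀ t, I i t → Runs S (.loop (.ilt q b)
      (.seq body (.seq (.instr (.iconst (q + 1) 1)) (.instr (.iadd q q (q + 1)))))) t
      (I n) (1 + k * (T + 3)) := by
    intro k
    induction k with
    | zero =>
      rintro i hi t ht
      obtain rfl : i = n := by omega
      exact ⟨t, 1, .loop_false (by simp [Test.Holds, (hI _ _ ht).1, (hI _ _ ht).2]), by omega, ht⟩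
    | succ k ih =>
      intro i hi t ht
      obtain ⟨u, l, he, hl, hu, hIu⟩ := hstep i (by omega) t ht
      obtain ⟨w, l', he', hl', hw⟩ := ih (i + 1) (by omega) _ hIu
      have e1 : Instr.step S u (.iconst (q + 1) 1) = some (u.setIdx (q + 1) 1) := by
        simp [Instr.step, hS]
      have e2 : Instr.step S (u.setIdx (q + 1) 1) (.iadd q q (q + 1)) =
          some ((u.setIdx (q + 1) 1).setIdx q (i + 1)) := by
        have : i + 1 ≤ S := by omega
        simp [Instr.step, State.setIdx, hu, this]
      refine ⟨w, _, .loop_true ?_ (.seq he (.seq (.instr e1) (.instr e2))) he', ?_, hw⟩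
      · simp only [Test.Holds, (hI _ _ ht).1, (hI _ _ ht).2]; omega
      · have : (k + 1) * (T + 3) = k * (T + 3) + T + 3 := by ring
        omega
  have := key n 0 (by omega) _ h0
  have e : Instr.step S s (.iconst q 0) = some (s.setIdx q 0) := by simp [Instr.step]
  exact (Runs.instr_seq e this).mono (by omega) (fun _ h => h)

/-! ### A language of real expressions and its compiler -/

/-- Real registers with smaller numbers are program variables, the other ones are scratch. -/
def tempBase : ℕ := 32

/-- Real expressions over real registers (`var`), index registers and the point list in memory.
`ite e f g h` is `if e < f then g else h`, `iite a b g h` compares index registers, `cell a b o` is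
entry `o` of the record of the point whose number is the difference of the index registers `a` and
`b` (and `0` if there is no such point), and `sum b e` sums `e` over the values smaller than index
register `b` of a bound index variable. Bound index variables are numbered by their level. -/
inductive Expr
  | const (z : ℤ)
  | var (r : ℕ)
  | add (e f : Expr)
  | sub (e f : Expr)
  | mul (e f : Expr)
  | div (e f : Expr)
  | sqrt (e : Expr)
  | ite (e f g h : Expr)
  | iite (a b : ℕ) (g h : Expr)
  | cell (a b o : ℕ)
  | sum (b : ℕ) (e : Expr)

namespace Expr

/-- The value of an expression, where `q` is the number of index variables in scope. Division by
zero and square roots of negative numbers have value zero. -/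
noncomputable def eval (μ : ℕ → ℝ) : Expr → ℕ → (ℕ → ℕ) → (ℕ → ℝ) → ℝ
  | const z, _, _, _ => z
  | var r, _, _, ρ => ρ r
  | add e f, q, ι, ρ => e.eval μ q ι ρ + f.eval μ q ι ρ
  | sub e f, q, ι, ρ => e.eval μ q ι ρ - f.eval μ q ι ρ
  | mul e f, q, ι, ρ => e.eval μ q ι ρ * f.eval μ q ι ρ
  | div e f, q, ι, ρ => e.eval μ q ι ρ / f.eval μ q ι ρ
  | sqrt e, q, ι, ρ => √(e.eval μ q ι ρ)
  | ite e f g h, q, ι, ρ =>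
      if e.eval μ q ι ρ < f.eval μ q ι ρ then g.eval μ q ι ρ else h.eval μ q ι ρ
  | iite a b g h, q, ι, ρ => if ι a < ι b then g.eval μ q ι ρ else h.eval μ q ι ρ
  | cell a b o, _, ι, _ => if ι a - ι b < ι 2 then μ (3 * (ι a - ι b) + o) else 0
  | sum b e, q, ι, ρ => ∑ i ∈ Finset.range (ι b), e.eval μ (q + 1) (Function.update ι q i) ρ

/-- All variables are in scope. -/
def WF : Expr → ℕ → Prop
  | const _, _ => True
  | var r, _ => r < tempBase
  | add e f, q => e.WF q ∧ f.WF q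
  | sub e f, q => e.WF q ∧ f.WF q
  | mul e f, q => e.WF q ∧ f.WF q
  | div e f, q => e.WF q ∧ f.WF q
  | sqrt e, q => e.WF q
  | ite e f g h, q => e.WF q ∧ f.WF q ∧ g.WF q ∧ h.WF q
  | iite a b g h, q => a < q ∧ b < q ∧ g.WF q ∧ h.WF q
  | cell a b o, q => a < q ∧ b < q ∧ o < 3
  | sum b e, q => b < q ∧ e.WF (q + 1)

/-- Code that puts the value of an expression in real register `d`, using as scratch only real
registers from `d` on and index registers from `q` on. -/
def code : Expr → ℕ → ℕ → Program
  | const z, _, d => .instr (.rconst d z)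
  | var r, _, d => .instr (.rcopy d r)
  | add e f, q, d => .seq (e.code q d) (.seq (f.code q (d + 1)) (.instr (.radd d d (d + 1))))
  | sub e f, q, d => .seq (e.code q d) (.seq (f.code q (d + 1)) (.instr (.rsub d d (d + 1))))
  | mul e f, q, d => .seq (e.code q d) (.seq (f.code q (d + 1)) (.instr (.rmul d d (d + 1))))
  | div e f, q, d => .seq (e.code q d) (.seq (f.code q (d + 1))
      (.seq (.instr (.rmul (d + 2) (d + 1) (d + 1))) (.seq (.instr (.rconst (d + 3) 0))
        (.cond (.rlt (d + 3) (d + 2)) (.instr (.rdiv d d (d + 1))) (.instr (.rconst d 0))))))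
  | sqrt e, q, d => .seq (e.code q d) (.seq (.instr (.rconst (d + 1) 0))
      (.cond (.rlt d (d + 1)) (.instr (.rconst d 0)) (.instr (.rsqrt d d))))
  | ite e f g h, q, d => .seq (e.code q d) (.seq (f.code q (d + 1))
      (.cond (.rlt d (d + 1)) (g.code q d) (h.code q d)))
  | iite a b g h, q, d => .cond (.ilt a b) (g.code q d) (h.code q d)
  | cell a b o, q, d => .seq (.instr (.isub q a b)) (.cond (.ilt q 2)
      (.seq (.instr (.iadd (q + 1) q q)) (.seq (.instr (.iadd q q (q + 1)))
        (.seq (.instr (.iconst (q + 1) o)) (.seq (.instr (.iadd q q (q + 1)))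
          (.instr (.load d q))))))
      (.instr (.rconst d 0)))
  | sum b e, q, d => .seq (.instr (.rconst d 0))
      (forCode q b (.seq (e.code (q + 1) (d + 1)) (.instr (.radd d d (d + 1)))))

/-- Bound for the running time of the code of an expression, if index register `i` is bounded by
`B i`. -/
def cost : Expr → ℕ → (ℕ → ℕ) → ℕ
  | const _, _, _ => 1
  | var _, _, _ => 1
  | add e f, q, B => e.cost q B + f.cost q B + 1
  | sub e f, q, B => e.cost q B + f.cost q B + 1
  | mul e f, q, B => e.cost q B + f.cost q B + 1
  | div e f, q, B => e.cost q B + f.cost q B + 5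
  | sqrt e, q, B => e.cost q B + 4
  | ite e f g h, q, B => e.cost q B + f.cost q B + g.cost q B + h.cost q B + 1
  | iite _ _ g h, q, B => g.cost q B + h.cost q B + 1
  | cell _ _ _, _, _ => 8
  | sum b e, q, B => 3 + B b * (e.cost (q + 1) (Function.update B q (B b)) + 4)

end Expr

/-- The machine state `s` agrees with the values `ι` of the first `q` index registers, the values
`ρ` of the real registers that are program variables, and the memory contents `μ`. -/
structure Rep (μ : ℕ → ℝ) (q : ℕ) (ι : ℕ → ℕ) (ρ : ℕ → ℝ) (s : State) : Prop where
  idx : ∀ i < q, s.idx i = ι i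
  reg : ∀ r < tempBase, s.reg r = ρ r
  mem : s.mem = μ

/-- The first `q` index registers are bounded by `B`, and a machine with `S` cells is large enough
to hold their values and the list of points. -/
structure Bounded (S : ℕ) (B : ℕ → ℕ) (q : ℕ) (ι : ℕ → ℕ) : Prop where
  scope : 3 ≤ q
  two_le : 2 ≤ S
  cells : 3 * ι 2 ≤ S
  le_size : ∀ i < q, ι i ≤ S
  le : ∀ i < q, ι i ≤ B i

theorem Bounded.bind {S q b i : ℕ} {B ι : ℕ → ℕ} (h : Bounded S B q ι) (hb : b < q)
    (hi : i < ι b) : Bounded S (Function.update B q (B b)) (q + 1) (Function.update ι q i) where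
  scope := by have := h.scope; omega
  two_le := h.two_le
  cells := by
    rw [Function.update_of_ne (by have := h.scope; omega)]
    exact h.cells
  le_size j hj := by
    rcases eq_or_ne j q with rfl | hne
    · simpa using hi.le.trans (h.le_size b hb)
    · rw [Function.update_of_ne hne]
      exact h.le_size j (by omega)
  le j hj := by
    rcases eq_or_ne j q with rfl | hne
    · simpa using hi.le.trans (h.le b hb)
    · rw [Function.update_of_ne hne, Function.update_of_ne hne]
      exact h.le j (by omega)

/-- The states agree up to scratch: memory, the index registers below `q` and the real registers
below `d`. -/
structure Keep (q d : ℕ) (s t : State) : Prop where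
  idx : ∀ i < q, t.idx i = s.idx i
  reg : ∀ r < d, t.reg r = s.reg r
  mem : t.mem = s.mem

namespace Keep

variable {q d q' d' i r : ℕ} {x : ℝ} {s t u : State}

theorem refl (q d : ℕ) (s : State) : Keep q d s s := ⟨fun _ _ => rfl, fun _ _ => rfl, rfl⟩

theorem trans (h : Keep q d s t) (h' : Keep q' d' t u) (hq : q ≤ q') (hd : d ≤ d') :
    Keep q d s u where
  idx i hi := (h'.idx i (by omega)).trans (h.idx i hi)
  reg i hi := (h'.reg i (by omega)).trans (h.reg i hi)
  mem := h'.mem.trans h.mem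

theorem setReg (h : Keep q d s t) (hr : d ≤ r) : Keep q d s (t.setReg r x) where
  idx := h.idx
  reg j hj := by
    rw [← h.reg j hj]
    exact Function.update_of_ne (by omega) _ _
  mem := h.mem

theorem setIdx (h : Keep q d s t) (hr : q ≤ r) : Keep q d s (t.setIdx r i) where
  idx j hj := by
    rw [← h.idx j hj]
    exact Function.update_of_ne (by omega) _ _
  reg := h.reg
  mem := h.mem

end Keep

theorem Rep.keep {μ : ℕ → ℝ} {q d : ℕ} {ι : ℕ → ℕ} {ρ : ℕ → ℝ} {s t : State}
    (h : Rep μ q ι ρ s) (hk : Keep q d s t) (hd : tempBase ≤ d) : Rep μ q ι ρ t where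
  idx i hi := (hk.idx i hi).trans (h.idx i hi)
  reg r hr := (hk.reg r (by omega)).trans (h.reg r hr)
  mem := hk.mem.trans h.mem

/-- Entering the scope of a bound index variable. -/
theorem Rep.bind {μ : ℕ → ℝ} {q i : ℕ} {ι : ℕ → ℕ} {ρ : ℕ → ℝ} {s : State}
    (h : Rep μ q ι ρ s) (hi : s.idx q = i) : Rep μ (q + 1) (Function.update ι q i) ρ s where
  idx j hj := by
    rcases eq_or_ne j q with rfl | hne
    · simpa using hi
    · rw [Function.update_of_ne hne]
      exact h.idx j (by omega)
  reg := h.reg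
  mem := h.mem

@[simp] theorem State.idx_setReg (s : State) (r : ℕ) (x : ℝ) : (s.setReg r x).idx = s.idx := rfl

@[simp] theorem State.reg_setIdx (s : State) (r i : ℕ) : (s.setIdx r i).reg = s.reg := rfl

@[simp] theorem State.mem_setIdx (s : State) (r i : ℕ) : (s.setIdx r i).mem = s.mem := rfl

@[simp] theorem State.reg_setReg (s : State) (r : ℕ) (x : ℝ) :
    (s.setReg r x).reg = Function.update s.reg r x := rfl

@[simp] theorem State.idx_setIdx (s : State) (r i : ℕ) :
    (s.setIdx r i).idx = Function.update s.idx r i := rfl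

/-- Two expressions evaluated one after the other into neighbouring registers. -/
theorem Runs.binary {S T T' q d : ℕ} {c c' p : Program} {s : State} {x y : ℝ} {T'' : ℕ}
    {Q : State → Prop}
    (h : Runs S c s (fun t => Keep q d s t ∧ t.reg d = x) T)
    (h' : ∀ t, Keep q d s t → Runs S c' t (fun u => Keep q (d + 1) t u ∧ u.reg (d + 1) = y) T')
    (h'' : ∀ u, Keep q d s u → u.reg d = x → u.reg (d + 1) = y → Runs S p u Q T'') :
    Runs S (.seq c (.seq c' p)) s Q (T + (T' + T'')) := by
  refine h.seq fun t ⟨hk, hx⟩ => (h' t hk).seq fun u ⟨hk', hy⟩ => h'' u ?_ ?_ hy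
  · exact hk.trans hk' le_rfl (by omega)
  · rw [hk'.reg d (by omega), hx]

/-- The compiled code computes the value of the expression. -/
theorem Expr.runs_code {S : ℕ} {μ : ℕ → ℝ} (e : Expr) : ∀ {q d : ℕ} {B ι : ℕ → ℕ} {ρ : ℕ → ℝ}
    {s : State}, tempBase ≤ d → e.WF q → Bounded S B q ι → Rep μ q ι ρ s →
    Runs S (e.code q d) s (fun t => Keep q d s t ∧ t.reg d = e.eval μ q ι ρ) (e.cost q B) := by
  induction e with
  | const z =>
    intro q d B ι ρ s hd _ _ hs
    exact .instr rfl ⟨(Keep.refl q d s).setReg le_rfl, by simp [eval]⟩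
  | var r =>
    intro q d B ι ρ s hd hw _ hs
    exact .instr rfl ⟨(Keep.refl q d s).setReg le_rfl, by simp [eval, hs.reg r hw]⟩
  | add e f ihe ihf =>
    intro q d B ι ρ s hd hw hB hs
    refine (Runs.binary (ihe hd hw.1 hB hs)
      (fun t hk => ihf (by omega) hw.2 hB (hs.keep hk hd)) (fun u hk hx hy =>
      Runs.instr rfl ⟨hk.setReg le_rfl, ?_⟩)).mono (by simp only [cost]; omega) (fun _ h => h)
    simp [hx, hy, eval]
  | sub e f ihe ihf =>
    intro q d B ι ρ s hd hw hB hs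
    refine (Runs.binary (ihe hd hw.1 hB hs)
      (fun t hk => ihf (by omega) hw.2 hB (hs.keep hk hd)) (fun u hk hx hy =>
      Runs.instr rfl ⟨hk.setReg le_rfl, ?_⟩)).mono (by simp only [cost]; omega) (fun _ h => h)
    simp [hx, hy, eval]
  | mul e f ihe ihf =>
    intro q d B ι ρ s hd hw hB hs
    refine (Runs.binary (ihe hd hw.1 hB hs)
      (fun t hk => ihf (by omega) hw.2 hB (hs.keep hk hd)) (fun u hk hx hy =>
      Runs.instr rfl ⟨hk.setReg le_rfl, ?_⟩)).mono (by simp only [cost]; omega) (fun _ h => h)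
    simp [hx, hy, eval]
  | div e f ihe ihf =>
    intro q d B ι ρ s hd hw hB hs
    refine (Runs.binary (ihe hd hw.1 hB hs)
      (fun t hk => ihf (by omega) hw.2 hB (hs.keep hk hd)) (fun u hk hx hy =>
      Runs.instr_seq rfl (Runs.instr_seq rfl (Runs.cond (T := 1) (T' := 1) (fun hb => ?_)
        (fun hb => ?_))))).mono (by simp only [cost]; omega) (fun _ h => h)
    · have hy0 : f.eval μ q ι ρ ≠ 0 := by
        intro h0
        simp [Test.Holds, hy, h0] at hb
      exact Runs.instr (by simp [Instr.step, hy, hy0]; rfl)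
        ⟨((hk.setReg (by omega)).setReg (by omega)).setReg le_rfl, by simp [eval, hx]⟩
    · have hy0 : f.eval μ q ι ρ = 0 := by
        by_contra h0
        exact hb (by simpa [Test.Holds, hy] using h0)
      exact Runs.instr rfl
        ⟨((hk.setReg (by omega)).setReg (by omega)).setReg le_rfl, by simp [eval, hy0]⟩
  | sqrt e ihe =>
    intro q d B ι ρ s hd hw hB hs
    refine ((ihe hd hw hB hs).seq fun t ⟨hk, hx⟩ => Runs.instr_seq rfl (Runs.cond (T := 1)
      (T' := 1) (fun hb => ?_) (fun hb => ?_))).mono (by simp only [cost]; omega) (fun _ h => h)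
    · have : e.eval μ q ι ρ ≤ 0 := by
        simp only [Test.Holds, State.reg_setReg, Function.update_self] at hb
        rw [Function.update_of_ne (by omega), hx] at hb
        exact_mod_cast hb.le
      exact Runs.instr rfl ⟨(hk.setReg (by omega)).setReg le_rfl,
        by simp [eval, Real.sqrt_eq_zero_of_nonpos this]⟩
    · have : 0 ≤ e.eval μ q ι ρ := by
        simp only [Test.Holds, State.reg_setReg, Function.update_self] at hb
        rw [Function.update_of_ne (by omega), hx] at hb
        exact_mod_cast not_lt.1 hb
      exact Runs.instr (by simp [Instr.step, hx, this]; rfl)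
        ⟨(hk.setReg (by omega)).setReg le_rfl, by simp [eval]⟩
  | ite e f g h ihe ihf ihg ihh =>
    intro q d B ι ρ s hd hw hB hs
    refine (Runs.binary (ihe hd hw.1 hB hs)
      (fun t hk => ihf (by omega) hw.2.1 hB (hs.keep hk hd)) (fun u hk hx hy =>
      Runs.cond (T := g.cost q B) (T' := h.cost q B) (fun hb => ?_) (fun hb => ?_))).mono
      (by simp only [cost]; omega) (fun _ h => h)
    · simp only [Test.Holds, hx, hy] at hb
      exact (ihg hd hw.2.2.1 hB (hs.keep hk hd)).mono le_rfl fun t ⟨hk', hz⟩ =>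
        ⟨hk.trans hk' le_rfl le_rfl, by simp [eval, hb, hz]⟩
    · simp only [Test.Holds, hx, hy] at hb
      exact (ihh hd hw.2.2.2 hB (hs.keep hk hd)).mono le_rfl fun t ⟨hk', hz⟩ =>
        ⟨hk.trans hk' le_rfl le_rfl, by simp [eval, hb, hz]⟩
  | iite a b g h ihg ihh =>
    intro q d B ι ρ s hd hw hB hs
    refine Runs.cond (T := g.cost q B) (T' := h.cost q B) (fun hb => ?_) (fun hb => ?_)
    · simp only [Test.Holds, hs.idx a hw.1, hs.idx b hw.2.1] at hb
      exact (ihg hd hw.2.2.1 hB hs).mono le_rfl fun t ⟨hk', hz⟩ => ⟨hk', by simp [eval, hb, hz]⟩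
    · simp only [Test.Holds, hs.idx a hw.1, hs.idx b hw.2.1] at hb
      exact (ihh hd hw.2.2.2 hB hs).mono le_rfl fun t ⟨hk', hz⟩ => ⟨hk', by simp [eval, hb, hz]⟩
  | cell a b o =>
    intro q d B ι ρ s hd hw hB hs
    obtain ⟨ha, hb, ho⟩ := hw
    have hq := hB.scope
    have hsub : ι a - ι b ≤ S := (Nat.sub_le _ _).trans (hB.le_size a ha)
    have e1 : Instr.step S s (.isub q a b) = some (s.setIdx q (ι a - ι b)) := by
      simp [Instr.step, hs.idx a ha, hs.idx b hb, hsub]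
    refine (Runs.instr_seq e1 (Runs.cond (T := 5) (T' := 1) (fun h => ?_)
      (fun h => ?_))).mono (by simp only [cost]; omega) (fun _ h => h)
    · have h2 : ι a - ι b < ι 2 := by
        simpa [Test.Holds, Function.update_of_ne (show (2 : ℕ) ≠ q by omega), hs.idx 2 hq] using h
      have hcells := hB.cells
      set x := ι a - ι b
      refine (Runs.instr_seq (t := (s.setIdx q x).setIdx (q + 1) (x + x)) ?_ <|
        Runs.instr_seq (t := ((s.setIdx q x).setIdx (q + 1) (x + x)).setIdx q (x + (x + x))) ?_ <|
        Runs.instr_seq (t := (((s.setIdx q x).setIdx (q + 1) (x + x)).setIdx q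
          (x + (x + x))).setIdx (q + 1) o) ?_ <|
        Runs.instr_seq (t := ((((s.setIdx q x).setIdx (q + 1) (x + x)).setIdx q
          (x + (x + x))).setIdx (q + 1) o).setIdx q (x + (x + x) + o)) ?_ <|
        Runs.instr (t := (((((s.setIdx q x).setIdx (q + 1) (x + x)).setIdx q
          (x + (x + x))).setIdx (q + 1) o).setIdx q (x + (x + x) + o)).setReg d
            (μ (x + (x + x) + o))) ?_ ⟨?_, ?_⟩)
      · simp [Instr.step]; omega
      · simp [Instr.step]; omega
      · simp [Instr.step]; omega
      · simp [Instr.step]; omega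
      · simp [Instr.step, hs.mem]; omega
      · refine Keep.setReg ?_ le_rfl
        refine ((((Keep.setIdx (Keep.refl q d s) ?_).setIdx ?_).setIdx ?_).setIdx ?_).setIdx ?_ <;>
          omega
      · have : 3 * x + o = x + (x + x) + o := by ring
        have h2' : ι a - ι b < ι 2 := h2
        simp only [State.reg_setReg, Function.update_self, eval, if_pos h2']
        rw [← this]
    · have h2 : ¬ ι a - ι b < ι 2 := by
        simpa [Test.Holds, Function.update_of_ne (show (2 : ℕ) ≠ q by omega), hs.idx 2 hq] using h
      refine Runs.instr rfl ⟨(Keep.setIdx (Keep.refl q d s) le_rfl).setReg le_rfl, ?_⟩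
      simp [eval, h2]
  | sum b e ih =>
    intro q d B ι ρ s hd hw hB hs
    have hq := hB.scope
    obtain ⟨hb, hw⟩ := hw
    refine (Runs.instr_seq rfl (Runs.mono (Runs.forCode (n := ι b)
      (T := e.cost (q + 1) (Function.update B q (B b)) + 1)
      (I := fun i t => t.idx q = i ∧ Keep q d s t ∧
        t.reg d = ∑ j ∈ Finset.range i, e.eval μ (q + 1) (Function.update ι q j) ρ)
      (hB.le_size b hb) (by have := hB.two_le; omega) ?_ ?_ ?_) le_rfl ?_)).mono
      (T := 1 + (2 + ι b * (e.cost (q + 1) (Function.update B q (B b)) + 1 + 3))) ?_ (fun _ h => h)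
    · exact ⟨by simp, (Keep.setReg (Keep.refl q d s) le_rfl).setIdx le_rfl, by simp⟩
    · rintro i t ⟨h1, hk, -⟩
      exact ⟨h1, (hk.idx b hb).trans (hs.idx b hb)⟩
    · rintro i hi t ⟨h1, hk, hx⟩
      refine (ih (d := d + 1) (by omega) hw (hB.bind hb hi) ((hs.keep hk hd).bind h1)).seq
        fun u ⟨hk', hy⟩ => Runs.instr rfl ⟨?_, ?_, ?_, ?_⟩
      · simp [hk'.idx q (by omega), h1]
      · simp
      · exact (((hk.trans hk' (by omega) (by omega)).setReg le_rfl).setIdx (by omega)).setIdx le_rfl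
      · simp [Finset.sum_range_succ, hy, hk'.reg d (by omega), hx]
    · rintro t ⟨-, hk, hx⟩
      exact ⟨hk, hx⟩
    · have := Nat.mul_le_mul_right (e.cost (q + 1) (Function.update B q (B b)) + 4) (hB.le b hb)
      simp only [cost, Nat.add_assoc, Nat.reduceAdd] at this ⊢
      omega

/-! ### A language of commands and its compiler -/

/-- Commands on the real registers that are program variables: assignments, sequences, counting
loops `loop b c` (run `c` for all values of a bound index variable smaller than index register `b`)
and `whenLT e f c` (run `c` if `e < f`). -/
inductive Cmd
  | assign (r : ℕ) (e : Expr)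
  | seq (c c' : Cmd)
  | loop (b : ℕ) (c : Cmd)
  | whenLT (e f : Expr) (c : Cmd)

namespace Cmd

/-- The values of the program variables after a command. -/
noncomputable def run (μ : ℕ → ℝ) : Cmd → ℕ → (ℕ → ℕ) → (ℕ → ℝ) → ℕ → ℝ
  | assign r e, q, ι, ρ => Function.update ρ r (e.eval μ q ι ρ)
  | seq c c', q, ι, ρ => c'.run μ q ι (c.run μ q ι ρ)
  | loop b c, q, ι, ρ =>
      Nat.rec ρ (fun i ρ' => c.run μ (q + 1) (Function.update ι q i) ρ') (ι b)
  | whenLT e f c, q, ι, ρ => if e.eval μ q ι ρ < f.eval μ q ι ρ then c.run μ q ι ρ else ρ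

/-- All variables are in scope. -/
def WF : Cmd → ℕ → Prop
  | assign r e, q => r < tempBase ∧ e.WF q
  | seq c c', q => c.WF q ∧ c'.WF q
  | loop b c, q => b < q ∧ c.WF (q + 1)
  | whenLT e f c, q => e.WF q ∧ f.WF q ∧ c.WF q

/-- Code for a command. -/
def code : Cmd → ℕ → Program
  | assign r e, q => .seq (e.code q tempBase) (.instr (.rcopy r tempBase))
  | seq c c', q => .seq (c.code q) (c'.code q)
  | loop b c, q => forCode q b (c.code (q + 1))
  | whenLT e f c, q => .seq (e.code q tempBase) (.seq (f.code q (tempBase + 1))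
      (.cond (.rlt tempBase (tempBase + 1)) (c.code q) (.instr .nop)))

/-- Bound for the running time of the code of a command, if index register `i` is bounded by
`B i`. -/
def cost : Cmd → ℕ → (ℕ → ℕ) → ℕ
  | assign _ e, q, B => e.cost q B + 1
  | seq c c', q, B => c.cost q B + c'.cost q B
  | loop b c, q, B => 2 + B b * (c.cost (q + 1) (Function.update B q (B b)) + 3)
  | whenLT e f c, q, B => e.cost q B + f.cost q B + c.cost q B + 2

/-- The compiled code has the effect of the command. -/
theorem runs_code {S : ℕ} {μ : ℕ → ℝ} (c : Cmd) : ∀ {q : ℕ} {B ι : ℕ → ℕ} {ρ : ℕ → ℝ}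
    {s : State}, c.WF q → Bounded S B q ι → Rep μ q ι ρ s →
    Runs S (c.code q) s (Rep μ q ι (c.run μ q ι ρ)) (c.cost q B) := by
  induction c with
  | assign r e =>
    intro q B ι ρ s hw hB hs
    refine (e.runs_code le_rfl hw.2 hB hs).seq fun t ⟨hk, hx⟩ => Runs.instr rfl ⟨?_, ?_, ?_⟩
    · exact (hs.keep hk le_rfl).idx
    · intro j hj
      simp only [State.reg_setReg, run]
      rcases eq_or_ne j r with rfl | hne
      · simp [hx]
      · rw [Function.update_of_ne hne, Function.update_of_ne hne]
        exact (hs.keep hk le_rfl).reg j hj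
    · exact (hs.keep hk le_rfl).mem
  | seq c c' ih ih' =>
    intro q B ι ρ s hw hB hs
    exact (ih hw.1 hB hs).seq fun t ht => ih' hw.2 hB ht
  | loop b c ih =>
    intro q B ι ρ s hw hB hs
    have hq := hB.scope
    obtain ⟨hb, hw⟩ := hw
    refine (Runs.forCode (n := ι b)
      (T := c.cost (q + 1) (Function.update B q (B b)))
      (I := fun i t => t.idx q = i ∧ Rep μ q ι
        (Nat.rec ρ (fun i ρ' => c.run μ (q + 1) (Function.update ι q i) ρ') i) t)
      (hB.le_size b hb) (by have := hB.two_le; omega) ?_ ?_ ?_).mono ?_ (fun t h => by exact h.2)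
    · exact ⟨by simp, hs.keep ((Keep.refl q tempBase s).setIdx le_rfl) le_rfl⟩
    · rintro i t ⟨h1, hk⟩
      exact ⟨h1, hk.idx b hb⟩
    · rintro i hi t ⟨h1, hk⟩
      refine (ih hw (hB.bind hb hi) (hk.bind h1)).mono le_rfl fun u hu => ⟨?_, by simp, ?_⟩
      · simp [hu.idx q (by omega)]
      · refine Rep.keep (d := tempBase) (s := u) ⟨fun j hj => ?_, hu.reg, hu.mem⟩
          (((Keep.refl q tempBase u).setIdx (by omega)).setIdx le_rfl) le_rfl
        rw [hu.idx j (by omega), Function.update_of_ne (by omega)]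
    · have := Nat.mul_le_mul_right (c.cost (q + 1) (Function.update B q (B b)) + 3) (hB.le b hb)
      simp only [cost]
      omega
  | whenLT e f c ih =>
    intro q B ι ρ s hw hB hs
    refine (Runs.binary (e.runs_code le_rfl hw.1 hB hs)
      (fun t hk => f.runs_code (by omega) hw.2.1 hB (hs.keep hk le_rfl)) (fun u hk hx hy =>
      Runs.cond (T := c.cost q B) (T' := 1) (fun hb => ?_) (fun hb => ?_))).mono
      (by simp only [cost]; omega) (fun _ h => h)
    · simp only [Test.Holds, hx, hy] at hb
      simp only [run, if_pos hb]
      exact ih hw.2.2 hB (hs.keep hk le_rfl)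
    · simp only [Test.Holds, hx, hy] at hb
      simp only [run, if_neg hb]
      exact Runs.instr rfl (hs.keep hk le_rfl)

end Cmd

/-! ### Sampling the faces of a line arrangement -/

/-- A sequence of lines `a k * x + b k * y + c k = 0` in the plane; degenerate equations with
`a k = b k = 0` are allowed. -/
structure Lines where
  a : ℕ → ℝ
  b : ℕ → ℝ
  c : ℕ → ℝ

namespace Lines

variable (L : Lines) (K : ℕ)

/-- The linear part of the equation of line `k`. -/
def slope (k : ℕ) (d : ℝ × ℝ) : ℝ := L.a k * d.1 + L.b k * d.2

/-- The left-hand side of the equation of line `k`. -/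
def value (k : ℕ) (p : ℝ × ℝ) : ℝ := L.a k * p.1 + L.b k * p.2 + L.c k

/-- The determinant of two lines; it vanishes iff they are parallel or one is degenerate. -/
def det (i j : ℕ) : ℝ := L.a i * L.b j - L.a j * L.b i

/-- The intersection of two lines (the origin, if they are parallel). -/
noncomputable def vertex (i j : ℕ) : ℝ × ℝ :=
  ((L.b i * L.c j - L.b j * L.c i) / L.det i j, (L.a j * L.c i - L.a i * L.c j) / L.det i j)

/-- A step in direction `d` from `p` that is too short to reach any of the first `K` lines not
passing through `p`. The lines through `p` contribute zero to the sum, as division by zero gives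
zero. -/
noncomputable def stepSize (p d : ℝ × ℝ) : ℝ :=
  1 / (1 + ∑ k ∈ Finset.range K, L.slope k d / L.value k p * (L.slope k d / L.value k p))

/-- The point reached from `p` by a short step in direction `d`. -/
noncomputable def move (p d : ℝ × ℝ) : ℝ × ℝ :=
  (p.1 + L.stepSize K p d * d.1, p.2 + L.stepSize K p d * d.2)

/-- The point reached from the intersection of the lines `i` and `j` by a short step along line `i`
and a short step perpendicular to it, the orientations being given by `σ` and `τ`. -/
noncomputable def sample (i j : ℕ) (σ τ : ℝ) : ℝ × ℝ :=
  L.move K (L.move K (L.vertex i j) (σ * -L.b i, σ * L.a i)) (τ * L.a i, τ * L.b i)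

theorem stepSize_pos (p d : ℝ × ℝ) : 0 < L.stepSize K p d := by
  have : 0 ≤ ∑ k ∈ Finset.range K, L.slope k d / L.value k p * (L.slope k d / L.value k p) :=
    Finset.sum_nonneg fun k _ => mul_self_nonneg _
  unfold stepSize
  positivity

theorem value_move (k : ℕ) (p d : ℝ × ℝ) :
    L.value k (L.move K p d) = L.value k p + L.stepSize K p d * L.slope k d := by
  simp only [value, move, slope]
  ring

theorem sign_eq_of_eq_mul {x y r : ℝ} (hr : 0 < r) (h : x = r * y) :
    SignType.sign x = SignType.sign y := by
  rw [h, sign_mul, sign_pos hr, one_mul]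

variable {L K}

theorem abs_stepSize_mul_lt {k : ℕ} (hk : k < K) (p d : ℝ × ℝ) :
    |L.stepSize K p d * (L.slope k d / L.value k p)| < 1 := by
  set z := L.slope k d / L.value k p with hz
  have hsum : z * z ≤
      ∑ k ∈ Finset.range K, L.slope k d / L.value k p * (L.slope k d / L.value k p) :=
    Finset.single_le_sum (f := fun k => L.slope k d / L.value k p * (L.slope k d / L.value k p))
      (fun k _ => mul_self_nonneg _) (Finset.mem_range.2 hk)
  rw [abs_mul, abs_of_pos (L.stepSize_pos K p d), stepSize, one_div_mul_eq_div,
    div_lt_one (by have := mul_self_nonneg z; linarith)]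
  have := abs_mul_abs_self z
  nlinarith [sq_nonneg (|z| - 1), abs_nonneg z]

/-- A short step does not change the sides of the lines that do not pass through the point. -/
theorem sign_move_of_ne {k : ℕ} (hk : k < K) {p d : ℝ × ℝ} (h : L.value k p ≠ 0) :
    SignType.sign (L.value k (L.move K p d)) = SignType.sign (L.value k p) := by
  have hlt := abs_lt.1 (abs_stepSize_mul_lt (L := L) hk p d)
  refine sign_eq_of_eq_mul
    (r := 1 + L.stepSize K p d * (L.slope k d / L.value k p)) (by linarith) ?_
  rw [value_move]
  field_simp

theorem sign_move_of_eq {k : ℕ} {p d : ℝ × ℝ} (h : L.value k p = 0) :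
    SignType.sign (L.value k (L.move K p d)) = SignType.sign (L.slope k d) :=
  sign_eq_of_eq_mul (L.stepSize_pos K p d) (by rw [value_move, h, zero_add])

theorem vertex_eq {i j : ℕ} {y : ℝ × ℝ} (hy : L.value i y = 0) (hd : L.det i j ≠ 0) :
    L.vertex i j = (y.1 + -L.value j y / L.det i j * -L.b i,
      y.2 + -L.value j y / L.det i j * L.a i) := by
  have hc : L.c i = -(L.a i * y.1 + L.b i * y.2) := by
    simp only [value] at hy
    linarith
  refine Prod.ext ?_ ?_ <;> simp only [vertex] <;> field_simp <;>
    simp only [value, det, hc] <;> ring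

/-- On a line, the affine function with slope `δ` vanishing at `θ` has the same sign at `0` and at
a point `τ` not farther from `0` than `θ`, unless `θ = τ`. -/
theorem sign_along {δ τ θ : ℝ} (h : τ ≠ 0) (hle : |τ| ≤ |θ|) (hne : θ ≠ τ) :
    SignType.sign (-θ * δ + τ * δ) = SignType.sign (-θ * δ) := by
  have hθ : θ ≠ 0 := by
    rintro rfl
    simp_all
  refine sign_eq_of_eq_mul (r := 1 - τ / θ) ?_ (by field_simp; ring)
  rw [sub_pos]
  have h1 : |τ / θ| ≤ 1 := by
    rw [abs_div]
    exact div_le_one_of_le₀ hle (abs_nonneg _)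
  refine lt_of_le_of_ne (le_of_abs_le h1) fun h2 => hne ?_
  rw [div_eq_one_iff_eq hθ] at h2
  exact h2.symm

/-- Every face of the arrangement inside line `i` is met by a point at most one short step along
line `i` away from a vertex: the vertex to choose is the one nearest to a given point of the
face. -/
theorem exists_sign_move_vertex {i : ℕ} (hi : ∃ j < K, L.det i j ≠ 0) {y : ℝ × ℝ}
    (hy : L.value i y = 0) :
    ∃ j < K, ∃ σ : SignType, ∀ k < K,
      SignType.sign (L.value k (L.move K (L.vertex i j) ((σ : ℝ) * -L.b i, (σ : ℝ) * L.a i))) =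
        SignType.sign (L.value k y) := by
  obtain ⟨j₀, hj₀, hd₀⟩ := hi
  -- `y` moved by `τ k` times the direction vector of line `i` lies on line `k`
  set τ : ℕ → ℝ := fun k => -L.value k y / L.det i k with hτ
  obtain ⟨j, hj, hmin⟩ := Finset.exists_min_image
    ((Finset.range K).filter fun k => L.det i k ≠ 0) (fun k => |τ k|)
    ⟨j₀, by simp [hj₀, hd₀]⟩
  simp only [Finset.mem_filter, Finset.mem_range] at hj hmin
  have hv : ∀ k, L.value k (L.vertex i j) = L.value k y + τ j * L.det i k := by
    intro k
    rw [vertex_eq hy hj.2]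
    simp only [value, det, hτ]
    ring
  refine ⟨j, hj.1, -SignType.sign (τ j), fun k hk => ?_⟩
  have hslope : L.slope k (((-SignType.sign (τ j) : SignType) : ℝ) * -L.b i,
      ((-SignType.sign (τ j) : SignType) : ℝ) * L.a i) =
      ((-SignType.sign (τ j) : SignType) : ℝ) * L.det i k := by
    simp only [slope, det]
    ring
  by_cases hdet : L.det i k = 0
  · have hvk : L.value k (L.vertex i j) = L.value k y := by rw [hv, hdet, mul_zero, add_zero]
    by_cases h0 : L.value k y = 0
    · rw [sign_move_of_eq (hvk.trans h0), hslope, hdet, mul_zero, h0]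
    · rw [sign_move_of_ne hk (by rwa [hvk]), hvk]
  · have hval : L.value k y = -τ k * L.det i k := by
      simp only [hτ]
      field_simp
    by_cases hτj : τ j = 0
    · have hvk : L.value k (L.vertex i j) = L.value k y := by rw [hv, hτj, zero_mul, add_zero]
      by_cases h0 : L.value k y = 0
      · rw [sign_move_of_eq (hvk.trans h0), hslope, hτj, h0]
        simp
      · rw [sign_move_of_ne hk (by rwa [hvk]), hvk]
    by_cases heq : τ k = τ j
    · rw [sign_move_of_eq (by rw [hv, hval, heq]; ring), hslope, hval, heq, sign_mul, sign_mul,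
        Left.sign_neg]
      congr 1
      rcases lt_or_gt_of_ne hτj with h | h <;> simp [h]
    · have hs := sign_along (δ := L.det i k) hτj (hmin k ⟨hk, hdet⟩) heq
      have hne : L.value k (L.vertex i j) ≠ 0 := by
        rw [hv, hval]
        intro h0
        have : (τ j - τ k) * L.det i k = 0 := by linarith
        rcases mul_eq_zero.1 this with h | h
        · exact heq (by linarith)
        · exact hdet h
      rw [sign_move_of_ne hk hne, hv, hval, hs]

/-- The sampling theorem: the samples meet every face of an arrangement of lines that are not all
parallel. -/
theorem exists_sign_sample (h : ∃ i < K, ∃ j < K, L.det i j ≠ 0) (p : ℝ × ℝ) :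
    ∃ i < K, ∃ j < K, ∃ σ τ : SignType, ∀ k < K,
      SignType.sign (L.value k (L.sample K i j σ τ)) = SignType.sign (L.value k p) := by
  obtain ⟨i₀, hi₀, j₀, hj₀, hd₀⟩ := h
  set nsq : ℕ → ℝ := fun k => L.a k ^ 2 + L.b k ^ 2 with hnsq
  have hpos : ∀ {k}, nsq k ≠ 0 → 0 < nsq k := fun {k} hk =>
    lt_of_le_of_ne (by simp only [hnsq]; positivity) hk.symm
  have hn₀ : nsq i₀ ≠ 0 := by
    intro h0
    have ha : L.a i₀ = 0 := by
      simp only [hnsq] at h0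
      nlinarith [sq_nonneg (L.a i₀), sq_nonneg (L.b i₀)]
    have hb : L.b i₀ = 0 := by
      simp only [hnsq] at h0
      nlinarith [sq_nonneg (L.a i₀), sq_nonneg (L.b i₀)]
    exact hd₀ (by simp [det, ha, hb])
  -- the line nearest to `p`
  obtain ⟨i, hi, hmin⟩ := Finset.exists_min_image
    ((Finset.range K).filter fun k => nsq k ≠ 0) (fun k => L.value k p ^ 2 / nsq k)
    ⟨i₀, by simp [hi₀, hn₀]⟩
  simp only [Finset.mem_filter, Finset.mem_range] at hi hmin
  have hni := hpos hi.2
  have hdet : ∃ j < K, L.det i j ≠ 0 := by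
    by_contra! hall
    have h1 := hall i₀ hi₀
    have h2 := hall j₀ hj₀
    simp only [det] at h1 h2 hd₀
    have ha : L.a i * (L.a i₀ * L.b j₀ - L.a j₀ * L.b i₀) = 0 := by
      linear_combination L.a i₀ * h2 - L.a j₀ * h1
    have hb : L.b i * (L.a i₀ * L.b j₀ - L.a j₀ * L.b i₀) = 0 := by
      linear_combination L.b i₀ * h2 - L.b j₀ * h1
    have ha' := (mul_eq_zero.1 ha).resolve_right hd₀
    have hb' := (mul_eq_zero.1 hb).resolve_right hd₀
    exact hi.2 (by simp [hnsq, ha', hb'])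
  -- the foot of the perpendicular from `p` to that line
  set s := L.value i p / nsq i with hs
  set y : ℝ × ℝ := (p.1 - s * L.a i, p.2 - s * L.b i) with hy
  set dot : ℕ → ℝ := fun k => L.a k * L.a i + L.b k * L.b i with hdot
  have hyk : ∀ k, L.value k y = L.value k p - s * dot k := by
    intro k
    simp only [value, hy, hdot]
    ring
  have hyi : L.value i y = 0 := by
    rw [hyk, hs]
    have : dot i = nsq i := by simp only [hdot, hnsq]; ring
    rw [this]
    field_simp
    ring
  obtain ⟨j, hj, σ, hσ⟩ := exists_sign_move_vertex hdet hyi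
  refine ⟨i, hi.1, j, hj, σ, SignType.sign (L.value i p), fun k hk => ?_⟩
  have hw := hσ k hk
  simp only [sample]
  set w := L.move K (L.vertex i j) ((σ : ℝ) * -L.b i, (σ : ℝ) * L.a i)
  by_cases h0 : L.value k y = 0
  · have hw0 : L.value k w = 0 := by rwa [h0, sign_zero, sign_eq_zero_iff] at hw
    have hval : L.value k p = s * dot k := by rw [hyk] at h0; linarith
    have hslope : L.slope k (((SignType.sign (L.value i p) : SignType) : ℝ) * L.a i,
        ((SignType.sign (L.value i p) : SignType) : ℝ) * L.b i) =
        ((SignType.sign (L.value i p) : SignType) : ℝ) * dot k := by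
      simp only [slope, hdot]
      ring
    rw [sign_move_of_eq hw0, hslope, hval, sign_mul, sign_mul]
    congr 1
    rw [hs, div_eq_mul_inv, sign_mul, sign_pos (inv_pos.2 hni), mul_one]
    rcases lt_trichotomy (L.value i p) 0 with h | h | h <;> simp [h]
  · have hw0 : L.value k w ≠ 0 := by
      intro hc
      rw [hc, sign_zero, eq_comm, sign_eq_zero_iff] at hw
      exact h0 hw
    rw [sign_move_of_ne hk hw0, hw]
    -- no line separates `p` from `y`, because line `i` is nearest to `p`
    have hle : (s * dot k) ^ 2 ≤ L.value k p ^ 2 := by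
      have hcs : dot k ^ 2 ≤ nsq k * nsq i := by
        simp only [hdot, hnsq]
        nlinarith [sq_nonneg (L.a k * L.b i - L.b k * L.a i)]
      by_cases hk0 : nsq k = 0
      · rw [hk0, zero_mul] at hcs
        rw [mul_pow, pow_eq_zero_iff two_ne_zero |>.1 (le_antisymm hcs (sq_nonneg _))]
        simpa using sq_nonneg (L.value k p)
      · have h1 := hmin k ⟨hk, hk0⟩
        have hnk := hpos hk0
        have h2 : s ^ 2 * nsq i = L.value i p ^ 2 / nsq i := by
          rw [hs]; field_simp
        calc (s * dot k) ^ 2 = s ^ 2 * dot k ^ 2 := by ring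
          _ ≤ s ^ 2 * (nsq k * nsq i) := by gcongr
          _ = L.value i p ^ 2 / nsq i * nsq k := by rw [← h2]; ring
          _ ≤ L.value k p ^ 2 / nsq k * nsq k := by gcongr
          _ = L.value k p ^ 2 := by field_simp
    rw [hyk] at h0 ⊢
    rcases lt_trichotomy (L.value k p) 0 with h | h | h
    · have h3 := sq_le_sq.1 hle
      rw [abs_of_neg h] at h3
      have := neg_abs_le (s * dot k)
      rw [sign_neg h, sign_neg (lt_of_le_of_ne (by linarith) h0)]
    · rw [h] at hle h0
      exact absurd (pow_eq_zero_iff two_ne_zero |>.1 (le_antisymm (by simpa using hle)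
        (sq_nonneg (s * dot k)))) (by simpa using h0)
    · have h3 := sq_le_sq.1 hle
      rw [abs_of_pos h] at h3
      have := le_abs_self (s * dot k)
      rw [sign_pos h, sign_pos (lt_of_le_of_ne (by linarith) (Ne.symm h0))]

end Lines

/-! ### Annuli with red points on both circles suffice -/

theorem Input.penalty_le {n m : ℕ} (P : Input n m) {A A' : Annulus}
    (hred : ∀ i, P.red i ∈ A'.region → P.red i ∈ A.region)
    (hblue : ∀ j, P.blue j ∈ A.region → P.blue j ∈ A'.region) : P.penalty A ≤ P.penalty A' := by
  refine add_le_add (Finset.sum_le_sum_of_subset_of_nonneg ?_ fun i _ _ => (P.redPenalty_pos i).le)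
    (Finset.sum_le_sum_of_subset_of_nonneg ?_ fun i _ _ => (P.bluePenalty_pos i).le)
  · intro i
    simp only [Finset.mem_filter, Finset.mem_univ, true_and]
    exact fun h h' => h (hred i h')
  · intro i
    simp only [Finset.mem_filter, Finset.mem_univ, true_and]
    exact hblue i

theorem dist_sq_coord (p c : Point) : dist p c ^ 2 = (p 0 - c 0) ^ 2 + (p 1 - c 1) ^ 2 := by
  rw [EuclideanSpace.dist_eq, Real.sq_sqrt (by positivity), Fin.sum_univ_two, Real.dist_eq,
    Real.dist_eq, sq_abs, sq_abs]

/-- Every closed circular ring (possibly a circle) with two of the red points can be replaced by a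
proper annulus with red points on both circles, covering the same red points and no further blue
points. If the covered red points have different distances from the center, the ring is shrunk;
otherwise the center is first moved a little. -/
theorem exists_annulus_of_two_red {n m : ℕ} {red : Fin n → Point} {blue : Fin m → Point}
    (hinj : Function.Injective red) {c₀ : Point} {r R : ℝ} (hr : 0 < r) {i₁ i₂ : Fin n}
    (hne : i₁ ≠ i₂) (h₁ : r ≤ dist (red i₁) c₀ ∧ dist (red i₁) c₀ ≤ R)
    (h₂ : r ≤ dist (red i₂) c₀ ∧ dist (red i₂) c₀ ≤ R) :
    ∃ (c : Point) (a b : Fin n), 0 < dist (red a) c ∧ dist (red a) c < dist (red b) c ∧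
      (∀ i, r ≤ dist (red i) c₀ ∧ dist (red i) c₀ ≤ R →
        dist (red a) c ≤ dist (red i) c ∧ dist (red i) c ≤ dist (red b) c) ∧
      ∀ j, dist (red a) c ≤ dist (blue j) c ∧ dist (blue j) c ≤ dist (red b) c →
        r ≤ dist (blue j) c₀ ∧ dist (blue j) c₀ ≤ R := by
  classical
  set F : Finset (Fin n) :=
    Finset.univ.filter fun i => r ≤ dist (red i) c₀ ∧ dist (red i) c₀ ≤ R with hF
  have hmem : ∀ i, i ∈ F ↔ r ≤ dist (red i) c₀ ∧ dist (red i) c₀ ≤ R := fun i => by simp [hF]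
  have hne' : F.Nonempty := ⟨i₁, (hmem _).2 h₁⟩
  obtain ⟨a, ha, hamin⟩ := F.exists_min_image (fun i => dist (red i) c₀) hne'
  obtain ⟨b, hb, hbmax⟩ := F.exists_max_image (fun i => dist (red i) c₀) hne'
  rw [hmem] at ha hb
  rcases (hamin b ((hmem b).2 hb)).lt_or_eq with hlt | heq
  · exact ⟨c₀, a, b, hr.trans_le ha.1, hlt,
      fun i hi => ⟨hamin i ((hmem i).2 hi), hbmax i ((hmem i).2 hi)⟩,
      fun j hj => ⟨ha.1.trans hj.1, hj.2.trans hb.2⟩⟩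
  set d := dist (red a) c₀ with hd
  have hall : ∀ i ∈ F, dist (red i) c₀ = d := fun i hi =>
    le_antisymm ((hbmax i hi).trans heq.ge) (hamin i hi)
  set v := red i₁ - red i₂ with hv
  have hcont : ∀ p : Point, Filter.Tendsto (fun ε : ℝ => dist p (c₀ + ε • v))
      (nhdsWithin 0 (Set.Ioi 0)) (nhds (dist p c₀)) := by
    intro p
    have : Continuous fun ε : ℝ => dist p (c₀ + ε • v) := by fun_prop
    simpa using (this.tendsto 0).mono_left nhdsWithin_le_nhds
  have hpos : ∀ᶠ ε in nhdsWithin (0 : ℝ) (Set.Ioi 0), ∀ i, i ∈ F →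
      0 < dist (red i) (c₀ + ε • v) := by
    refine Filter.eventually_all.2 fun i => ?_
    by_cases hi : i ∈ F
    · filter_upwards [(hcont (red i)).eventually (lt_mem_nhds
        (hr.trans_le ((hmem i).1 hi).1))] with ε hε _ using hε
    · simp [hi]
  have hbl : ∀ᶠ ε in nhdsWithin (0 : ℝ) (Set.Ioi 0), ∀ j i, i ∈ F →
      (dist (blue j) c₀ < d → dist (blue j) (c₀ + ε • v) < dist (red i) (c₀ + ε • v)) ∧
      (d < dist (blue j) c₀ → dist (red i) (c₀ + ε • v) < dist (blue j) (c₀ + ε • v)) := by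
    refine Filter.eventually_all.2 fun j => Filter.eventually_all.2 fun i => ?_
    by_cases hi : i ∈ F
    · rcases lt_trichotomy (dist (blue j) c₀) d with h | h | h
      · filter_upwards [(hcont (blue j)).eventually_lt (hcont (red i)) (by rwa [hall i hi])]
          with ε hε _
        exact ⟨fun _ => hε, fun h' => absurd h h'.not_gt⟩
      · simp [h]
      · filter_upwards [(hcont (red i)).eventually_lt (hcont (blue j)) (by rwa [hall i hi])]
          with ε hε _
        exact ⟨fun h' => absurd h h'.not_gt, fun _ => hε⟩
    · simp [hi]
  obtain ⟨ε, ⟨hε1, hε2⟩, hε0⟩ := ((hpos.and hbl).and self_mem_nhdsWithin).exists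
  set c := c₀ + ε • v with hc
  obtain ⟨a', ha', hamin'⟩ := F.exists_min_image (fun i => dist (red i) c) hne'
  obtain ⟨b', hb', hbmax'⟩ := F.exists_max_image (fun i => dist (red i) c) hne'
  have hdiff : dist (red i₁) c ≠ dist (red i₂) c := by
    intro h
    have e₁ := hall i₁ ((hmem _).2 h₁)
    have e₂ := hall i₂ ((hmem _).2 h₂)
    have hsq : dist (red i₁) c₀ ^ 2 = dist (red i₂) c₀ ^ 2 := by rw [e₁, e₂]
    have hsq' : dist (red i₁) c ^ 2 = dist (red i₂) c ^ 2 := by rw [h]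
    have h0 : dist (red i₁) (red i₂) ^ 2 = 0 := by
      rw [dist_sq_coord, dist_sq_coord] at hsq hsq'
      rw [dist_sq_coord]
      simp only [hc, hv, PiLp.add_apply, PiLp.smul_apply, PiLp.sub_apply, smul_eq_mul] at hsq'
      have : ε * ((red i₁ 0 - red i₂ 0) ^ 2 + (red i₁ 1 - red i₂ 1) ^ 2) = 0 := by
        linear_combination (hsq - hsq') / 2
      exact (mul_eq_zero.1 this).resolve_left hε0.ne'
    exact hne (hinj (dist_eq_zero.1 (pow_eq_zero_iff two_ne_zero |>.1 h0)))
  have hlt : dist (red a') c < dist (red b') c := by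
    refine lt_of_le_of_ne (hamin' b' hb') fun h => hdiff (le_antisymm ?_ ?_)
    · exact ((hbmax' _ ((hmem _).2 h₁)).trans h.ge).trans (hamin' _ ((hmem _).2 h₂))
    · exact ((hbmax' _ ((hmem _).2 h₂)).trans h.ge).trans (hamin' _ ((hmem _).2 h₁))
  refine ⟨c, a', b', hε1 a' ha', hlt,
    fun i hi => ⟨hamin' i ((hmem i).2 hi), hbmax' i ((hmem i).2 hi)⟩, fun j hj => ?_⟩
  rcases lt_trichotomy (dist (blue j) c₀) d with h | h | h
  · exact absurd ((hε2 j a' ha').1 h) hj.1.not_gt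
  · exact h ▸ ha
  · exact absurd ((hε2 j b' hb').2 h) hj.2.not_gt

/-- Some point of the bisector of `q` and `q'` is the center of a circle through `q` and `q'` that
avoids finitely many given points. -/
theorem exists_equidistant_avoiding {m : ℕ} {q q' : Point} (hq : q ≠ q') (blue : Fin m → Point)
    (h : ∀ j, blue j ≠ q) (h' : ∀ j, blue j ≠ q') :
    ∃ c : Point, dist q c = dist q' c ∧ ∀ j, dist (blue j) c ≠ dist q c := by
  set c : ℝ → Point := fun t =>
    !₂[(q 0 + q' 0) / 2 - t * (q' 1 - q 1), (q 1 + q' 1) / 2 + t * (q' 0 - q 0)] with hc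
  have hc0 : ∀ t, c t 0 = (q 0 + q' 0) / 2 - t * (q' 1 - q 1) := fun t => by simp [hc]
  have hc1 : ∀ t, c t 1 = (q 1 + q' 1) / 2 + t * (q' 0 - q 0) := fun t => by simp [hc]
  have hD : (q' 0 - q 0) ^ 2 + (q' 1 - q 1) ^ 2 ≠ 0 := by
    rw [← dist_sq_coord]
    exact pow_ne_zero 2 (dist_ne_zero.2 hq.symm)
  have hfin : ∀ j, {t | dist (blue j) (c t) = dist q (c t)}.Finite := by
    refine fun j => Set.Subsingleton.finite fun t ht t' ht' => ?_
    by_contra htt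
    have e : dist (blue j) (c t) ^ 2 = dist q (c t) ^ 2 := by rw [ht]
    have e' : dist (blue j) (c t') ^ 2 = dist q (c t') ^ 2 := by rw [ht']
    rw [dist_sq_coord, dist_sq_coord, hc0, hc1] at e e'
    -- with respect to `q`, the point has coordinates `u` along `q' - q` and `w` across it
    set u := (blue j 0 - q 0) * (q' 0 - q 0) + (blue j 1 - q 1) * (q' 1 - q 1) with hu
    set w := (blue j 0 - q 0) * (q' 1 - q 1) - (blue j 1 - q 1) * (q' 0 - q 0) with hw
    have hw0 : w = 0 := by
      have : (t - t') * w = 0 := by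
        rw [hw]
        linear_combination (e - e') / 2
      exact (mul_eq_zero.1 this).resolve_left (sub_ne_zero.2 htt)
    have hu0 : (blue j 0 - q 0) ^ 2 + (blue j 1 - q 1) ^ 2 = u := by
      rw [hu]
      linear_combination e - 2 * t * hw0
    have huu : u * (u - ((q' 0 - q 0) ^ 2 + (q' 1 - q 1) ^ 2)) = 0 := by
      have : u ^ 2 + w ^ 2 = ((blue j 0 - q 0) ^ 2 + (blue j 1 - q 1) ^ 2) *
          ((q' 0 - q 0) ^ 2 + (q' 1 - q 1) ^ 2) := by rw [hu, hw]; ring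
      rw [hu0, hw0] at this
      linear_combination this
    rcases mul_eq_zero.1 huu with h0 | h0
    · refine h j (dist_eq_zero.1 (pow_eq_zero_iff two_ne_zero |>.1 ?_))
      rw [dist_sq_coord, hu0, h0]
    · refine h' j (dist_eq_zero.1 (pow_eq_zero_iff two_ne_zero |>.1 ?_))
      rw [dist_sq_coord]
      linear_combination hu0 - h0 + 2 * hu
  obtain ⟨t, ht⟩ := (Set.finite_iUnion hfin).infinite_compl.nonempty
  refine ⟨c t, ?_, fun j hj => ht (Set.mem_iUnion.2 ⟨j, hj⟩)⟩
  rw [← sq_eq_sq₀ dist_nonneg dist_nonneg, dist_sq_coord, dist_sq_coord, hc0, hc1]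
  ring

/-- If there are two red points, every annulus can be replaced by one that has red points on both
circles without increasing the penalty. -/
theorem Input.exists_red_boundary {n m : ℕ} (P : Input n m) (hn : 2 ≤ n) (A' : Annulus) :
    ∃ (A : Annulus) (a b : Fin n), A.rIn = dist (P.red a) A.center ∧
      A.rOut = dist (P.red b) A.center ∧ P.penalty A ≤ P.penalty A' := by
  by_cases htwo : ∃ i₁ i₂, i₁ ≠ i₂ ∧ P.red i₁ ∈ A'.region ∧ P.red i₂ ∈ A'.region
  · obtain ⟨i₁, i₂, hne, h₁, h₂⟩ := htwo
    obtain ⟨c, a, b, h0, hlt, hred, hblue⟩ :=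
      exists_annulus_of_two_red (blue := P.blue) P.red_injective A'.rIn_pos hne h₁ h₂
    exact ⟨⟨c, _, _, h0, hlt⟩, a, b, rfl, rfl, P.penalty_le hred hblue⟩
  · -- at most the red point `i₁` is covered
    obtain ⟨i₁, hi₁⟩ : ∃ i₁, ∀ i, P.red i ∈ A'.region → i = i₁ := by
      by_cases hone : ∃ i₁, P.red i₁ ∈ A'.region
      · obtain ⟨i₁, h₁⟩ := hone
        exact ⟨i₁, fun i hi => by_contra fun hne => htwo ⟨i, i₁, hne, hi, h₁⟩⟩
      · exact ⟨⟨0, by omega⟩, fun i hi => absurd ⟨i, hi⟩ hone⟩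
    have : Nontrivial (Fin n) := Fin.nontrivial_iff_two_le.2 hn
    obtain ⟨i₂, hne⟩ := exists_ne i₁
    obtain ⟨c₀, heq, hav⟩ := exists_equidistant_avoiding (P.red_injective.ne hne.symm) P.blue
      (fun j => (P.red_ne_blue _ j).symm) (fun j => (P.red_ne_blue _ j).symm)
    have hpos : 0 < dist (P.red i₁) c₀ := by
      rw [dist_pos]
      intro h
      rw [h, dist_self, eq_comm, dist_eq_zero] at heq
      exact hne (P.red_injective (heq.trans h.symm))
    obtain ⟨c, a, b, h0, hlt, hred, hblue⟩ :=
      exists_annulus_of_two_red (blue := P.blue) P.red_injective (R := dist (P.red i₁) c₀)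
        hpos hne.symm ⟨le_rfl, le_rfl⟩ ⟨heq.le, heq.ge⟩
    refine ⟨⟨c, _, _, h0, hlt⟩, a, b, rfl, rfl, P.penalty_le (fun i hi => ?_) (fun j hj => ?_)⟩
    · exact hred i (by rw [hi₁ i hi]; exact ⟨le_rfl, le_rfl⟩)
    · exact absurd (le_antisymm (hblue j hj).2 (hblue j hj).1) (hav j)

/-! ### The search program -/

/-- Entry `o` of the record of point `k` (for `k < N`) or `k - N` (for `N ≤ k < 2 * N`). -/
noncomputable def entry (N : ℕ) (μ : ℕ → ℝ) (o k : ℕ) : ℝ :=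
  if k < N then μ (3 * k + o) else if k - N < N then μ (3 * (k - N) + o) else 0

/-- The lines that matter for annuli with `p` on the inner and `q` on the outer circle: the
bisectors of `p` and the input points, the bisectors of `q` and the input points, and the two
parallels to the axes through `p`, which separate `p` itself from all other centers. -/
noncomputable def pairLines (N : ℕ) (μ : ℕ → ℝ) (p q : ℝ × ℝ) : Lines where
  a k := if k < 2 * N then -2 * (entry N μ 0 k - if k < N then p.1 else q.1)
    else if 2 * N < k then 0 else 1
  b k := if k < 2 * N then -2 * (entry N μ 1 k - if k < N then p.2 else q.2)
    else if 2 * N < k then 1 else 0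
  c k := if k < 2 * N then entry N μ 0 k * entry N μ 0 k + entry N μ 1 k * entry N μ 1 k -
      ((if k < N then p.1 else q.1) * (if k < N then p.1 else q.1) +
        (if k < N then p.2 else q.2) * (if k < N then p.2 else q.2))
    else if 2 * N < k then 0 - p.2 else 0 - p.1

/-- Squared Euclidean distance in coordinates. -/
def distSq (p c : ℝ × ℝ) : ℝ := (p.1 - c.1) * (p.1 - c.1) + (p.2 - c.2) * (p.2 - c.2)

/-- The penalty of the annulus with center `c` and squared radii `u` and `v`, computed from the
list of the `N` input points, the first `n` of which are red. -/
noncomputable def listPenalty (n N : ℕ) (μ : ℕ → ℝ) (c : ℝ × ℝ) (u v : ℝ) : ℝ :=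
  ∑ k ∈ Finset.range N,
    if k < n then
      if distSq (μ (3 * k), μ (3 * k + 1)) c < u then μ (3 * k + 2)
      else if v < distSq (μ (3 * k), μ (3 * k + 1)) c then μ (3 * k + 2) else 0
    else
      if distSq (μ (3 * k), μ (3 * k + 1)) c < u then 0
      else if v < distSq (μ (3 * k), μ (3 * k + 1)) c then 0 else μ (3 * k + 2)

namespace Expr

/-- Entry `o` of a point; index register `2` holds the number of points, register `6` zero. -/
def entry (o k : ℕ) : Expr := iite k 2 (cell k 6 o) (cell k 2 o)

/-- The coefficient `a` of line `k` of `pairLines`; real registers `5` to `8` hold the two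
points and index register `4` twice the number of points. -/
def lineA (k : ℕ) : Expr :=
  iite k 4 (mul (const (-2)) (sub (entry 0 k) (iite k 2 (var 5) (var 7))))
    (iite 4 k (const 0) (const 1))

/-- The coefficient `b`; see `lineA`. -/
def lineB (k : ℕ) : Expr :=
  iite k 4 (mul (const (-2)) (sub (entry 1 k) (iite k 2 (var 6) (var 8))))
    (iite 4 k (const 1) (const 0))

/-- The constant term `c`; see `lineA`. -/
def lineC (k : ℕ) : Expr :=
  iite k 4 (sub (add (mul (entry 0 k) (entry 0 k)) (mul (entry 1 k) (entry 1 k)))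
      (add (mul (iite k 2 (var 5) (var 7)) (iite k 2 (var 5) (var 7)))
        (mul (iite k 2 (var 6) (var 8)) (iite k 2 (var 6) (var 8)))))
    (iite 4 k (sub (const 0) (var 6)) (sub (const 0) (var 5)))

/-- `Lines.slope` divided by `Lines.value`, at line `k`. -/
def ratio (k x y u v : ℕ) : Expr :=
  div (add (mul (lineA k) (var u)) (mul (lineB k) (var v)))
    (add (add (mul (lineA k) (var x)) (mul (lineB k) (var y))) (lineC k))

/-- `Lines.stepSize` at the point in registers `x`, `y` in the direction in registers `u`, `v`;
index register `3` holds the number of lines, and `q` is the number of index variables in scope. -/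
def stepSize (q x y u v : ℕ) : Expr :=
  div (const 1) (add (const 1) (sum 3 (mul (ratio q x y u v) (ratio q x y u v))))

/-- `distSq` of two points given by expressions for their coordinates. -/
def sqDist (x y x' y' : Expr) : Expr :=
  add (mul (sub x x') (sub x x')) (mul (sub y y') (sub y y'))

/-- `listPenalty` of the annulus with center in registers `27`, `28` and squared radii in
registers `29`, `30`; `q` is the number of index variables in scope. -/
def penalty (q : ℕ) : Expr :=
  let d := sqDist (cell q 6 0) (cell q 6 1) (var 27) (var 28)
  sum 2 (iite q 0
    (ite d (var 29) (cell q 6 2) (ite (var 30) d (cell q 6 2) (const 0)))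
    (ite d (var 29) (const 0) (ite (var 30) d (const 0) (cell q 6 2))))

/-- The sign `-1`, `0` or `1` given by the value `0`, `1` or `2` of an index register. -/
def sign (b : ℕ) : Expr := sub (sum b (const 1)) (const 1)

end Expr

namespace Cmd

open RedBlueAnnulus.Expr

/-- Load the two red points into registers `5` to `8`. -/
def loadPair : Cmd :=
  .seq (assign 5 (cell 7 6 0)) (.seq (assign 6 (cell 7 6 1))
    (.seq (assign 7 (cell 8 6 0)) (assign 8 (cell 8 6 1))))

/-- Compute the coefficients of the two lines, in registers `9` to `14`. -/
def loadLines : Cmd :=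
  .seq (assign 9 (lineA 9)) (.seq (assign 10 (lineB 9)) (.seq (assign 11 (lineC 9))
    (.seq (assign 12 (lineA 10)) (.seq (assign 13 (lineB 10)) (assign 14 (lineC 10))))))

/-- Compute the intersection of the two lines, in registers `15` and `16`. -/
def vertex : Cmd :=
  .seq (assign 15 (div (sub (mul (var 10) (var 14)) (mul (var 13) (var 11)))
      (sub (mul (var 9) (var 13)) (mul (var 12) (var 10)))))
    (assign 16 (div (sub (mul (var 12) (var 11)) (mul (var 9) (var 14)))
      (sub (mul (var 9) (var 13)) (mul (var 12) (var 10)))))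

/-- Take the step along the first line, to the point in registers `22` and `23`. -/
def moveAlong : Cmd :=
  .seq (assign 17 (sign 11)) (.seq (assign 19 (mul (var 17) (sub (const 0) (var 10))))
    (.seq (assign 20 (mul (var 17) (var 9))) (.seq (assign 21 (stepSize 13 15 16 19 20))
      (.seq (assign 22 (add (var 15) (mul (var 21) (var 19))))
        (assign 23 (add (var 16) (mul (var 21) (var 20))))))))

/-- Take the step across the first line, to the center in registers `27` and `28`. -/
def moveAcross : Cmd :=
  .seq (assign 18 (sign 12)) (.seq (assign 24 (mul (var 18) (var 9)))
    (.seq (assign 25 (mul (var 18) (var 10))) (.seq (assign 26 (stepSize 13 22 23 24 25))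
      (.seq (assign 27 (add (var 22) (mul (var 26) (var 24))))
        (assign 28 (add (var 23) (mul (var 26) (var 25))))))))

/-- Compute the squared radii and the penalty, in registers `29` to `31`. -/
def evaluate : Cmd :=
  .seq (assign 29 (sqDist (var 5) (var 6) (var 27) (var 28)))
    (.seq (assign 30 (sqDist (var 7) (var 8) (var 27) (var 28))) (assign 31 (penalty 13)))

/-- Record the current annulus, if it is a proper annulus better than the recorded one. A negative
penalty in register `4` says that none has been recorded. -/
def record : Cmd :=
  whenLT (const 0) (var 29) (whenLT (var 29) (var 30)
    (whenLT (const 0) (ite (var 4) (const 0) (const 1) (sub (var 4) (var 31)))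
      (.seq (assign 0 (var 27)) (.seq (assign 1 (var 28)) (.seq (assign 2 (sqrt (var 29)))
        (.seq (assign 3 (sqrt (var 30))) (assign 4 (var 31))))))))

/-- Treat the annulus given by two red points (index registers `7`, `8`), two lines (`9`, `10`)
and two signs (`11`, `12`). -/
def tryCandidate : Cmd :=
  .seq loadPair (.seq loadLines (.seq vertex (.seq moveAlong (.seq moveAcross
    (.seq evaluate record)))))

/-- Try all candidates. -/
def search : Cmd := loop 0 (loop 0 (loop 3 (loop 3 (loop 5 (loop 5 tryCandidate)))))

/-- An annulus with the given red point on its outer circle and without other points. -/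
def isolate : Cmd :=
  .seq (assign 5 (cell 7 6 0)) (.seq (assign 6 (cell 7 6 1)) (.seq (assign 7 (var 5))
    (.seq (assign 8 (var 6)) (.seq (assign 19 (const 1)) (.seq (assign 20 (const 0))
      (.seq (assign 21 (stepSize 8 5 6 19 20))
        (.seq (assign 0 (add (var 5) (mul (var 21) (var 19))))
          (.seq (assign 1 (add (var 6) (mul (var 21) (var 20))))
            (.seq (assign 2 (div (var 21) (const 2))) (assign 3 (var 21)))))))))))

/-- The main part of the algorithm: search and, if nothing has been recorded (which happens only for
a single red point), isolate the red point. Its number comes from the index variable of the loop. -/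
def main : Cmd :=
  .seq (assign 4 (const (-1))) (.seq search (loop 0 (whenLT (var 4) (const 0) isolate)))

end Cmd

/-! ### What the search program computes -/

/-- The index registers below `7` hold the parameters of the input. -/
structure Params (n N : ℕ) (ι : ℕ → ℕ) : Prop where
  red : ι 0 = n
  points : ι 2 = N
  lines : ι 3 = 2 * N + 2
  twice : ι 4 = 2 * N
  three : ι 5 = 3
  zero : ι 6 = 0

theorem Params.bind {n N q i : ℕ} {ι : ℕ → ℕ} (h : Params n N ι) (hq : 7 ≤ q) :
    Params n N (Function.update ι q i) := by
  constructor <;> rw [Function.update_of_ne (by omega)]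
  exacts [h.red, h.points, h.lines, h.twice, h.three, h.zero]

namespace Expr

variable {n N q : ℕ} {μ : ℕ → ℝ} {ι : ℕ → ℕ} {ρ : ℕ → ℝ}

theorem eval_entry (h : Params n N ι) (o k : ℕ) :
    (entry o k).eval μ q ι ρ = RedBlueAnnulus.entry N μ o (ι k) := by
  simp only [entry, eval, RedBlueAnnulus.entry, h.points, h.zero, Nat.sub_zero]
  split_ifs <;> rfl

theorem eval_lineA (h : Params n N ι) (k : ℕ) :
    (lineA k).eval μ q ι ρ = (pairLines N μ (ρ 5, ρ 6) (ρ 7, ρ 8)).a (ι k) := by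
  simp only [lineA, eval, eval_entry h, pairLines, h.points, h.twice]
  push_cast
  rfl

theorem eval_lineB (h : Params n N ι) (k : ℕ) :
    (lineB k).eval μ q ι ρ = (pairLines N μ (ρ 5, ρ 6) (ρ 7, ρ 8)).b (ι k) := by
  simp only [lineB, eval, eval_entry h, pairLines, h.points, h.twice]
  push_cast
  rfl

theorem eval_lineC (h : Params n N ι) (k : ℕ) :
    (lineC k).eval μ q ι ρ = (pairLines N μ (ρ 5, ρ 6) (ρ 7, ρ 8)).c (ι k) := by
  simp only [lineC, eval, eval_entry h, pairLines, h.points, h.twice]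
  push_cast
  rfl

theorem eval_stepSize (h : Params n N ι) (hq : 7 ≤ q) (x y u v : ℕ) :
    (stepSize q x y u v).eval μ q ι ρ =
      (pairLines N μ (ρ 5, ρ 6) (ρ 7, ρ 8)).stepSize (2 * N + 2) (ρ x, ρ y) (ρ u, ρ v) := by
  simp only [stepSize, ratio, eval, Lines.stepSize, Lines.slope, Lines.value, h.lines,
    eval_lineA (h.bind hq), eval_lineB (h.bind hq), eval_lineC (h.bind hq), Function.update_self,
    Int.cast_one]

theorem eval_penalty (h : Params n N ι) (hq : 7 ≤ q) :
    (penalty q).eval μ q ι ρ = listPenalty n N μ (ρ 27, ρ 28) (ρ 29) (ρ 30) := by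
  simp only [penalty, eval, listPenalty, h.points]
  refine Finset.sum_congr rfl fun k hk => ?_
  rw [Finset.mem_range] at hk
  simp only [sqDist, eval, distSq, (h.bind hq).zero, (h.bind hq).points,
    (h.bind hq).red, Function.update_self, Nat.sub_zero, hk, if_true, add_zero, Int.cast_zero]
  congr!

theorem eval_sign (b : ℕ) : (sign b).eval μ q ι ρ = (ι b : ℝ) - 1 := by
  simp [sign, eval]

end Expr

namespace Cmd

/-- The command does not assign to register `r`. -/
def Avoids (r : ℕ) : Cmd → Prop
  | assign r' _ => r ≠ r'
  | seq c c' => c.Avoids r ∧ c'.Avoids r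
  | loop _ c => c.Avoids r
  | whenLT _ _ c => c.Avoids r

theorem run_of_avoids {μ : ℕ → ℝ} {r : ℕ} (c : Cmd) : ∀ {q : ℕ} {ι : ℕ → ℕ} {ρ : ℕ → ℝ},
    c.Avoids r → c.run μ q ι ρ r = ρ r := by
  induction c with
  | assign r' e => exact fun h => Function.update_of_ne h _ _
  | seq c c' ih ih' => exact fun h => (ih' h.2).trans (ih h.1)
  | loop b c ih =>
    intro q ι ρ h
    simp only [run]
    induction ι b with
    | zero => rfl
    | succ k ihk => exact (ih h).trans ihk
  | whenLT e f c ih =>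
    intro q ι ρ h
    simp only [run]
    split_ifs
    · exact ih h
    · rfl

/-- Running the command preserves the property `G` of the program variables. -/
def Keeps (μ : ℕ → ℝ) (G : (ℕ → ℝ) → Prop) (c : Cmd) (q : ℕ) (ι : ℕ → ℕ) : Prop :=
  ∀ ρ, G ρ → G (c.run μ q ι ρ)

/-- Running the command establishes the property `G` of the program variables. -/
def Reaches (μ : ℕ → ℝ) (G : (ℕ → ℝ) → Prop) (c : Cmd) (q : ℕ) (ι : ℕ → ℕ) : Prop :=
  ∀ ρ, G (c.run μ q ι ρ)

variable {μ : ℕ → ℝ} {G : (ℕ → ℝ) → Prop} {c : Cmd} {q b : ℕ} {ι : ℕ → ℕ}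

theorem Keeps.loop (h : ∀ i < ι b, Keeps μ G c (q + 1) (Function.update ι q i)) :
    Keeps μ G (loop b c) q ι := by
  intro ρ hρ
  have : ∀ k ≤ ι b,
      G (Nat.rec ρ (fun i ρ' => c.run μ (q + 1) (Function.update ι q i) ρ') k) := by
    intro k
    induction k with
    | zero => exact fun _ => hρ
    | succ k ih => exact fun hk => h k (by omega) _ (ih (by omega))
  exact this _ le_rfl

theorem Reaches.loop {i : ℕ} (hi : i < ι b)
    (h : Reaches μ G c (q + 1) (Function.update ι q i))
    (hk : ∀ i < ι b, Keeps μ G c (q + 1) (Function.update ι q i)) :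
    Reaches μ G (loop b c) q ι := by
  intro ρ
  have : ∀ k ≤ ι b, i < k →
      G (Nat.rec ρ (fun i ρ' => c.run μ (q + 1) (Function.update ι q i) ρ') k) := by
    intro k
    induction k with
    | zero => exact fun _ h => absurd h (Nat.not_lt_zero _)
    | succ k ih =>
      intro hk' hik
      rcases Nat.lt_succ_iff_lt_or_eq.1 hik with hlt | rfl
      · exact hk k (by omega) _ (ih (by omega) hlt)
      · exact h _
  exact this _ le_rfl hi

variable {n N : ℕ} {ρ : ℕ → ℝ}

/-- The coordinates of an input point. -/
def coords (μ : ℕ → ℝ) (k : ℕ) : ℝ × ℝ := (μ (3 * k), μ (3 * k + 1))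

/-- The center tried for the values `ι` of the index variables. -/
noncomputable def center (N : ℕ) (μ : ℕ → ℝ) (ι : ℕ → ℕ) : ℝ × ℝ :=
  (pairLines N μ (coords μ (ι 7)) (coords μ (ι 8))).sample (2 * N + 2) (ι 9) (ι 10)
    ((ι 11 : ℝ) - 1) ((ι 12 : ℝ) - 1)

theorem run_loadPair (h : Params n N ι) (h7 : ι 7 < N) (h8 : ι 8 < N) :
    (loadPair.run μ 13 ι ρ 5, loadPair.run μ 13 ι ρ 6) = coords μ (ι 7) ∧
    (loadPair.run μ 13 ι ρ 7, loadPair.run μ 13 ι ρ 8) = coords μ (ι 8) := by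
  simp [loadPair, run, Expr.eval, coords, h.points, h.zero, h7, h8]

theorem run_loadLines (h : Params n N ι) (L : Lines)
    (hL : pairLines N μ (ρ 5, ρ 6) (ρ 7, ρ 8) = L) :
    loadLines.run μ 13 ι ρ 9 = L.a (ι 9) ∧ loadLines.run μ 13 ι ρ 10 = L.b (ι 9) ∧
    loadLines.run μ 13 ι ρ 11 = L.c (ι 9) ∧ loadLines.run μ 13 ι ρ 12 = L.a (ι 10) ∧
    loadLines.run μ 13 ι ρ 13 = L.b (ι 10) ∧ loadLines.run μ 13 ι ρ 14 = L.c (ι 10) := by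
  simp [loadLines, run, Expr.eval_lineA h, Expr.eval_lineB h, Expr.eval_lineC h,
    hL]

theorem run_vertex {L : Lines} {i j : ℕ} (h9 : ρ 9 = L.a i) (h10 : ρ 10 = L.b i)
    (h11 : ρ 11 = L.c i) (h12 : ρ 12 = L.a j) (h13 : ρ 13 = L.b j) (h14 : ρ 14 = L.c j) :
    (vertex.run μ 13 ι ρ 15, vertex.run μ 13 ι ρ 16) = L.vertex i j := by
  simp [vertex, run, Expr.eval, Lines.vertex, Lines.det, *]

theorem run_moveAlong (h : Params n N ι) (L : Lines)
    (hL : pairLines N μ (ρ 5, ρ 6) (ρ 7, ρ 8) = L) :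
    (moveAlong.run μ 13 ι ρ 22, moveAlong.run μ 13 ι ρ 23) =
      L.move (2 * N + 2) (ρ 15, ρ 16) (((ι 11 : ℝ) - 1) * -ρ 10, ((ι 11 : ℝ) - 1) * ρ 9) := by
  simp [moveAlong, run, Expr.eval, Expr.eval_sign, Expr.eval_stepSize h, Lines.move, hL]

theorem run_moveAcross (h : Params n N ι) (L : Lines)
    (hL : pairLines N μ (ρ 5, ρ 6) (ρ 7, ρ 8) = L) :
    (moveAcross.run μ 13 ι ρ 27, moveAcross.run μ 13 ι ρ 28) =
      L.move (2 * N + 2) (ρ 22, ρ 23) (((ι 12 : ℝ) - 1) * ρ 9, ((ι 12 : ℝ) - 1) * ρ 10) := by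
  simp [moveAcross, run, Expr.eval, Expr.eval_sign, Expr.eval_stepSize h, Lines.move, hL]

theorem run_evaluate (h : Params n N ι) :
    evaluate.run μ 13 ι ρ 29 = distSq (ρ 5, ρ 6) (ρ 27, ρ 28) ∧
    evaluate.run μ 13 ι ρ 30 = distSq (ρ 7, ρ 8) (ρ 27, ρ 28) ∧
    evaluate.run μ 13 ι ρ 31 = listPenalty n N μ (ρ 27, ρ 28)
      (distSq (ρ 5, ρ 6) (ρ 27, ρ 28)) (distSq (ρ 7, ρ 8) (ρ 27, ρ 28)) := by
  simp [evaluate, run, Expr.eval, Expr.eval_penalty h, Expr.sqDist, distSq]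

/-- The registers holding the recorded annulus after a new annulus with center `c`, squared radii
`u` and `v` and penalty `w` has been considered. -/
structure Recorded (c : ℝ × ℝ) (u v w : ℝ) (ρ ρ' : ℕ → ℝ) : Prop where
  pos (h : 0 < u ∧ u < v ∧ (ρ 4 < 0 ∨ w < ρ 4)) :
    ρ' 0 = c.1 ∧ ρ' 1 = c.2 ∧ ρ' 2 = √u ∧ ρ' 3 = √v ∧ ρ' 4 = w
  neg (h : ¬ (0 < u ∧ u < v ∧ (ρ 4 < 0 ∨ w < ρ 4))) : ∀ r < 5, ρ' r = ρ r

theorem recorded_record :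
    Recorded (ρ 27, ρ 28) (ρ 29) (ρ 30) (ρ 31) ρ (record.run μ 13 ι ρ) := by
  have key : (0 < if ρ 4 < 0 then (1 : ℝ) else ρ 4 - ρ 31) ↔ (ρ 4 < 0 ∨ ρ 31 < ρ 4) := by
    split_ifs with h <;> simp [h]
  constructor
  · rintro ⟨h1, h2, h3⟩
    rw [← key] at h3
    simp [record, run, Expr.eval, h1, h2, h3]
  · intro h r hr
    rw [← key] at h
    by_cases h1 : 0 < ρ 29
    · by_cases h2 : ρ 29 < ρ 30
      · have h3 : ¬ 0 < if ρ 4 < 0 then (1 : ℝ) else ρ 4 - ρ 31 := fun h3 => h ⟨h1, h2, h3⟩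
        simp [record, run, Expr.eval, h1, h2, h3]
      · simp [record, run, Expr.eval, h1, h2]
    · simp [record, run, Expr.eval, h1]

theorem recorded_tryCandidate (h : Params n N ι) (h7 : ι 7 < N) (h8 : ι 8 < N) :
    Recorded (center N μ ι) (distSq (coords μ (ι 7)) (center N μ ι))
      (distSq (coords μ (ι 8)) (center N μ ι))
      (listPenalty n N μ (center N μ ι) (distSq (coords μ (ι 7)) (center N μ ι))
        (distSq (coords μ (ι 8)) (center N μ ι))) ρ (tryCandidate.run μ 13 ι ρ) := by
  set L := pairLines N μ (coords μ (ι 7)) (coords μ (ι 8)) with hL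
  set ρ₁ := loadPair.run μ 13 ι ρ with hρ₁
  set ρ₂ := loadLines.run μ 13 ι ρ₁ with hρ₂
  set ρ₃ := vertex.run μ 13 ι ρ₂ with hρ₃
  set ρ₄ := moveAlong.run μ 13 ι ρ₃ with hρ₄
  set ρ₅ := moveAcross.run μ 13 ι ρ₄ with hρ₅
  set ρ₆ := evaluate.run μ 13 ι ρ₅ with hρ₆
  have e₁ : ∀ r < 5, ρ₁ r = ρ r := fun r hr => run_of_avoids _ (by simp [loadPair, Avoids]; omega)
  have e₂ : ∀ r < 9, ρ₂ r = ρ₁ r := fun r hr => run_of_avoids _ (by simp [loadLines, Avoids]; omega)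
  have e₃ : ∀ r < 15, ρ₃ r = ρ₂ r := fun r hr => run_of_avoids _ (by simp [vertex, Avoids]; omega)
  have e₄ : ∀ r < 17, ρ₄ r = ρ₃ r := fun r hr =>
    run_of_avoids _ (by simp [moveAlong, Avoids]; omega)
  have e₅ : ∀ r < 18, ρ₅ r = ρ₄ r := fun r hr =>
    run_of_avoids _ (by simp [moveAcross, Avoids]; omega)
  have e₆ : ∀ r < 29, ρ₆ r = ρ₅ r := fun r hr =>
    run_of_avoids _ (by simp [evaluate, Avoids]; omega)
  obtain ⟨hp, hq⟩ := run_loadPair (μ := μ) (ρ := ρ) h h7 h8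
  rw [← hρ₁] at hp hq
  have f₃ : ∀ r < 9, ρ₃ r = ρ₁ r := fun r hr => (e₃ r (by omega)).trans (e₂ r hr)
  have f₄ : ∀ r < 9, ρ₄ r = ρ₁ r := fun r hr => (e₄ r (by omega)).trans (f₃ r hr)
  have f₅ : ∀ r < 9, ρ₅ r = ρ₁ r := fun r hr => (e₅ r (by omega)).trans (f₄ r hr)
  obtain ⟨l1, l2, l3, l4, l5, l6⟩ := run_loadLines (μ := μ) (ρ := ρ₁) h L (by rw [hp, hq])
  rw [← hρ₂] at l1 l2 l3 l4 l5 l6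
  have hv := run_vertex (μ := μ) (ι := ι) l1 l2 l3 l4 l5 l6
  rw [← hρ₃] at hv
  have hw := run_moveAlong (μ := μ) (ρ := ρ₃) h L (by
    rw [f₃ 5 (by omega), f₃ 6 (by omega), f₃ 7 (by omega), f₃ 8 (by omega), hp, hq])
  rw [← hρ₄, hv, e₃ 9 (by omega), e₃ 10 (by omega), l1, l2] at hw
  have hc := run_moveAcross (μ := μ) (ρ := ρ₄) h L (by
    rw [f₄ 5 (by omega), f₄ 6 (by omega), f₄ 7 (by omega), f₄ 8 (by omega), hp, hq])
  rw [← hρ₅, hw, e₄ 9 (by omega), e₄ 10 (by omega), e₃ 9 (by omega), e₃ 10 (by omega), l1, l2]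
    at hc
  replace hc : (ρ₅ 27, ρ₅ 28) = center N μ ι := hc
  obtain ⟨h29, h30, h31⟩ := run_evaluate (μ := μ) (ρ := ρ₅) h
  rw [f₅ 5 (by omega), f₅ 6 (by omega), hp, hc] at h29
  rw [f₅ 7 (by omega), f₅ 8 (by omega), hq, hc] at h30
  rw [f₅ 5 (by omega), f₅ 6 (by omega), f₅ 7 (by omega), f₅ 8 (by omega), hp, hq, hc] at h31
  rw [← hρ₆] at h29 h30 h31
  have hrec := recorded_record (μ := μ) (ι := ι) (ρ := ρ₆)
  rw [e₆ 27 (by omega), e₆ 28 (by omega), hc, h29, h30, h31] at hrec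
  have g : ∀ r < 5, ρ₆ r = ρ r := fun r hr =>
    (e₆ r (by omega)).trans ((f₅ r (by omega)).trans (e₁ r hr))
  have hrun : tryCandidate.run μ 13 ι ρ = record.run μ 13 ι ρ₆ := rfl
  rw [hrun]
  exact ⟨fun hh => hrec.pos (by rwa [g 4 (by omega)]),
    fun hh r hr => (hrec.neg (by rwa [g 4 (by omega)]) r hr).trans (g r hr)⟩

end Cmd

/-! ### Correctness of the search -/

/-- The coordinates of a point of the plane. -/
def Point.toProd (p : Point) : ℝ × ℝ := (p 0, p 1)

theorem distSq_toProd (p c : Point) : distSq p.toProd c.toProd = dist p c ^ 2 := by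
  rw [dist_sq_coord, distSq]
  simp only [Point.toProd]
  ring

section Loaded

variable {n m : ℕ} {P : Input n m} {s : State}

theorem Loaded.coords_red (h : Loaded P s) (i : Fin n) :
    Cmd.coords s.mem i = (P.red i).toProd := by
  obtain ⟨h0, h1, -⟩ := h.red i
  simp [Cmd.coords, Point.toProd, h0, h1]

theorem Loaded.coords_blue (h : Loaded P s) (j : Fin m) :
    Cmd.coords s.mem (n + j) = (P.blue j).toProd := by
  obtain ⟨h0, h1, -⟩ := h.blue j
  simp [Cmd.coords, Point.toProd, h0, h1]

theorem Annulus.mem_region_iff (A : Annulus) (p : Point) :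
    p ∈ A.region ↔ ¬ distSq p.toProd A.center.toProd < A.rIn ^ 2 ∧
      ¬ A.rOut ^ 2 < distSq p.toProd A.center.toProd := by
  have h1 := A.rIn_pos
  have h2 := A.rIn_lt_rOut
  rw [distSq_toProd, sq_lt_sq₀ dist_nonneg h1.le, sq_lt_sq₀ (h1.trans h2).le dist_nonneg, not_lt,
    not_lt]
  rfl

theorem Loaded.listPenalty_eq (h : Loaded P s) (A : Annulus) :
    listPenalty n (n + m) s.mem A.center.toProd (A.rIn ^ 2) (A.rOut ^ 2) = P.penalty A := by
  classical
  rw [listPenalty, Finset.sum_range_add, Input.penalty, Finset.sum_range, Finset.sum_range,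
    Finset.sum_filter, Finset.sum_filter]
  congr 1
  · refine Finset.sum_congr rfl fun i _ => ?_
    have e := h.coords_red i
    rw [Cmd.coords] at e
    rw [if_pos i.2, e, (h.red i).2.2, A.mem_region_iff]
    split_ifs <;> simp_all
  · refine Finset.sum_congr rfl fun j _ => ?_
    have e := h.coords_blue j
    rw [Cmd.coords] at e
    rw [if_neg (by omega), e, (h.blue j).2.2, A.mem_region_iff]
    split_ifs <;> simp_all

theorem Input.penalty_nonneg (P : Input n m) (A : Annulus) : 0 ≤ P.penalty A :=
  add_nonneg (Finset.sum_nonneg fun i _ => (P.redPenalty_pos i).le)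
    (Finset.sum_nonneg fun i _ => (P.bluePenalty_pos i).le)

/-- The annulus tried for the red points `a` and `b` and a given center. -/
theorem Loaded.exists_annulus (h : Loaded P s) (a b : Fin n) {c : ℝ × ℝ}
    (h0 : 0 < distSq (P.red a).toProd c)
    (hlt : distSq (P.red a).toProd c < distSq (P.red b).toProd c) :
    ∃ A : Annulus, A.center.toProd = c ∧ A.rIn = √(distSq (P.red a).toProd c) ∧
      A.rOut = √(distSq (P.red b).toProd c) ∧ P.red a ∈ A.innerCircle ∧ P.red b ∈ A.outerCircle ∧
      listPenalty n (n + m) s.mem c (distSq (P.red a).toProd c) (distSq (P.red b).toProd c) =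
        P.penalty A := by
  obtain ⟨p, rfl⟩ : ∃ p : Point, p.toProd = c := ⟨!₂[c.1, c.2], by simp [Point.toProd]⟩
  have e1 := distSq_toProd (P.red a) p
  have e2 := distSq_toProd (P.red b) p
  rw [e1] at h0 hlt ⊢
  rw [e2] at hlt ⊢
  rw [Real.sqrt_sq dist_nonneg, Real.sqrt_sq dist_nonneg]
  have hin : 0 < dist (P.red a) p := dist_nonneg.lt_of_ne fun h' => by simp [← h'] at h0
  have hout : dist (P.red a) p < dist (P.red b) p := lt_of_pow_lt_pow_left₀ 2 dist_nonneg hlt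
  exact ⟨⟨p, _, _, hin, hout⟩, rfl, rfl, rfl, rfl, rfl, h.listPenalty_eq ⟨p, _, _, hin, hout⟩⟩

end Loaded

section Lines

variable {n N : ℕ} {μ : ℕ → ℝ} {p q c c' : ℝ × ℝ} {k : ℕ}

theorem value_left (hk : k < N) :
    (pairLines N μ p q).value k c = distSq (Cmd.coords μ k) c - distSq p c := by
  have h2 : k < 2 * N := by omega
  simp only [Lines.value, pairLines, entry, Cmd.coords, distSq, if_pos hk, if_pos h2, add_zero]
  ring

theorem value_right (hk : k < N) :
    (pairLines N μ p q).value (N + k) c = distSq (Cmd.coords μ k) c - distSq q c := by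
  have h1 : ¬ N + k < N := by omega
  have h2 : N + k < 2 * N := by omega
  simp only [Lines.value, pairLines, entry, Cmd.coords, distSq, if_neg h1, if_pos h2,
    Nat.add_sub_cancel_left, if_pos hk, add_zero]
  ring

theorem value_vertical : (pairLines N μ p q).value (2 * N) c = c.1 - p.1 := by
  simp only [Lines.value, pairLines, lt_irrefl, if_false]
  ring

theorem value_horizontal : (pairLines N μ p q).value (2 * N + 1) c = c.2 - p.2 := by
  have h1 : ¬ 2 * N + 1 < 2 * N := by omega
  simp only [Lines.value, pairLines, if_neg h1, Nat.lt_succ_self, if_true]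
  ring

theorem exists_det_ne_zero :
    ∃ i < 2 * N + 2, ∃ j < 2 * N + 2, (pairLines N μ p q).det i j ≠ 0 := by
  refine ⟨2 * N, by omega, 2 * N + 1, by omega, ?_⟩
  have h1 : ¬ 2 * N + 1 < 2 * N := by omega
  simp [Lines.det, pairLines, h1]

theorem neg_iff_of_sign_eq {x y : ℝ} (h : SignType.sign x = SignType.sign y) :
    x < 0 ↔ y < 0 := by
  rw [← sign_eq_neg_one_iff, h, sign_eq_neg_one_iff]

theorem pos_iff_of_sign_eq {x y : ℝ} (h : SignType.sign x = SignType.sign y) :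
    0 < x ↔ 0 < y := by
  rw [← sign_eq_one_iff, h, sign_eq_one_iff]

/-- Centers in the same face of the arrangement give annuli that cover the same points. -/
theorem listPenalty_congr (h : ∀ k < 2 * N + 2,
    SignType.sign ((pairLines N μ p q).value k c') =
      SignType.sign ((pairLines N μ p q).value k c)) :
    listPenalty n N μ c' (distSq p c') (distSq q c') =
      listPenalty n N μ c (distSq p c) (distSq q c) := by
  refine Finset.sum_congr rfl fun k hk => ?_
  rw [Finset.mem_range] at hk
  have h1 := neg_iff_of_sign_eq (h k (by omega))
  have h2 := pos_iff_of_sign_eq (h (N + k) (by omega))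
  rw [value_left hk, value_left hk, sub_neg, sub_neg, Cmd.coords] at h1
  rw [value_right hk, value_right hk, sub_pos, sub_pos, Cmd.coords] at h2
  simp only [h1, h2]

theorem distSq_pos_iff : 0 < distSq p c ↔ c.1 - p.1 ≠ 0 ∨ c.2 - p.2 ≠ 0 := by
  constructor
  · intro h
    by_contra! h'
    rw [distSq, ← neg_sub c.1, ← neg_sub c.2, h'.1, h'.2] at h
    simp at h
  · rw [distSq]
    rintro (h | h)
    · have := mul_self_pos.2 h
      nlinarith [mul_self_nonneg (p.2 - c.2)]
    · have := mul_self_pos.2 h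
      nlinarith [mul_self_nonneg (p.1 - c.1)]

theorem distSq_pos_of_sign_eq (h : ∀ k < 2 * N + 2,
    SignType.sign ((pairLines N μ p q).value k c') =
      SignType.sign ((pairLines N μ p q).value k c)) (h0 : 0 < distSq p c) : 0 < distSq p c' := by
  have h1 := h (2 * N) (by omega)
  have h2 := h (2 * N + 1) (by omega)
  rw [value_vertical, value_vertical] at h1
  rw [value_horizontal, value_horizontal] at h2
  rw [distSq_pos_iff] at h0 ⊢
  rwa [← sign_ne_zero, h1, sign_ne_zero, ← sign_ne_zero (a := c'.2 - p.2), h2, sign_ne_zero]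

end Lines

namespace Cmd

variable {n m : ℕ} {P : Input n m} {s : State} {ι : ℕ → ℕ} {ρ : ℕ → ℝ}

/-- The annulus `A` with red points on both circles is recorded together with its penalty. -/
structure IsRecord (P : Input n m) (A : Annulus) (ρ : ℕ → ℝ) : Prop where
  centerX : ρ 0 = A.center 0
  centerY : ρ 1 = A.center 1
  rIn : ρ 2 = A.rIn
  rOut : ρ 3 = A.rOut
  penalty : ρ 4 = P.penalty A
  red : ∃ a b, P.red a ∈ A.innerCircle ∧ P.red b ∈ A.outerCircle

/-- Either nothing or a correct annulus is recorded. -/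
def Sound (P : Input n m) (ρ : ℕ → ℝ) : Prop := ρ 4 < 0 ∨ ∃ A, IsRecord P A ρ

/-- An annulus of penalty at most `w` is recorded. -/
def AtMost (w : ℝ) (ρ : ℕ → ℝ) : Prop := 0 ≤ ρ 4 ∧ ρ 4 ≤ w

theorem keeps_sound_tryCandidate (h : Loaded P s) (hι : Params n (n + m) ι) (h7 : ι 7 < n)
    (h8 : ι 8 < n) : Keeps s.mem (Sound P) tryCandidate 13 ι := by
  intro ρ hρ
  have hrec := recorded_tryCandidate (μ := s.mem) (ρ := ρ) hι (by omega) (by omega)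
  have e7 := h.coords_red ⟨ι 7, h7⟩
  have e8 := h.coords_red ⟨ι 8, h8⟩
  simp only at e7 e8
  rw [e7, e8] at hrec
  by_cases hc : 0 < distSq (P.red ⟨ι 7, h7⟩).toProd (center (n + m) s.mem ι) ∧
      distSq (P.red ⟨ι 7, h7⟩).toProd (center (n + m) s.mem ι) <
        distSq (P.red ⟨ι 8, h8⟩).toProd (center (n + m) s.mem ι) ∧ (ρ 4 < 0 ∨
      listPenalty n (n + m) s.mem (center (n + m) s.mem ι)
        (distSq (P.red ⟨ι 7, h7⟩).toProd (center (n + m) s.mem ι))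
        (distSq (P.red ⟨ι 8, h8⟩).toProd (center (n + m) s.mem ι)) < ρ 4)
  · obtain ⟨A, hA, hin, hout, ha, hb, hp⟩ := h.exists_annulus _ _ hc.1 hc.2.1
    obtain ⟨r0, r1, r2, r3, r4⟩ := hrec.pos hc
    refine Or.inr ⟨A, ?_, ?_, r2.trans hin.symm, r3.trans hout.symm, r4.trans hp, _, _, ha, hb⟩
    · rw [r0, ← hA]; rfl
    · rw [r1, ← hA]; rfl
  · have e := hrec.neg hc
    rcases hρ with hneg | ⟨A, hA⟩
    · exact Or.inl (by rwa [e 4 (by omega)])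
    · refine Or.inr ⟨A, ?_, ?_, ?_, ?_, ?_, hA.red⟩
      · rw [e 0 (by omega), hA.centerX]
      · rw [e 1 (by omega), hA.centerY]
      · rw [e 2 (by omega), hA.rIn]
      · rw [e 3 (by omega), hA.rOut]
      · rw [e 4 (by omega), hA.penalty]

theorem keeps_atMost_tryCandidate (h : Loaded P s) (hι : Params n (n + m) ι) (h7 : ι 7 < n)
    (h8 : ι 8 < n) (w : ℝ) : Keeps s.mem (AtMost w) tryCandidate 13 ι := by
  intro ρ hρ
  have hrec := recorded_tryCandidate (μ := s.mem) (ρ := ρ) hι (by omega) (by omega)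
  have e7 := h.coords_red ⟨ι 7, h7⟩
  have e8 := h.coords_red ⟨ι 8, h8⟩
  simp only at e7 e8
  rw [e7, e8] at hrec
  by_cases hc : 0 < distSq (P.red ⟨ι 7, h7⟩).toProd (center (n + m) s.mem ι) ∧
      distSq (P.red ⟨ι 7, h7⟩).toProd (center (n + m) s.mem ι) <
        distSq (P.red ⟨ι 8, h8⟩).toProd (center (n + m) s.mem ι) ∧ (ρ 4 < 0 ∨
      listPenalty n (n + m) s.mem (center (n + m) s.mem ι)
        (distSq (P.red ⟨ι 7, h7⟩).toProd (center (n + m) s.mem ι))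
        (distSq (P.red ⟨ι 8, h8⟩).toProd (center (n + m) s.mem ι)) < ρ 4)
  · obtain ⟨A, -, -, -, -, -, hp⟩ := h.exists_annulus _ _ hc.1 hc.2.1
    have r4 := (hrec.pos hc).2.2.2.2
    have hlt := hc.2.2.resolve_left hρ.1.not_gt
    exact ⟨by rw [r4, hp]; exact P.penalty_nonneg A, by rw [r4]; exact hlt.le.trans hρ.2⟩
  · have e := hrec.neg hc 4 (by omega)
    rw [AtMost, e]
    exact hρ

/-- Trying a candidate that covers the right points leaves a record that is at least as good. -/
theorem reaches_tryCandidate (h : Loaded P s) (hι : Params n (n + m) ι) {a b : Fin n}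
    (h7 : ι 7 = a) (h8 : ι 8 = b) {A : Annulus} (hin : A.rIn = dist (P.red a) A.center)
    (hout : A.rOut = dist (P.red b) A.center)
    (hsign : ∀ k < 2 * (n + m) + 2,
      SignType.sign ((pairLines (n + m) s.mem (P.red a).toProd (P.red b).toProd).value k
        (center (n + m) s.mem ι)) =
      SignType.sign ((pairLines (n + m) s.mem (P.red a).toProd (P.red b).toProd).value k
        A.center.toProd)) :
    Reaches s.mem (AtMost (P.penalty A)) tryCandidate 13 ι := by
  intro ρ
  have hrec := recorded_tryCandidate (μ := s.mem) (ρ := ρ) hι (by omega) (by omega)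
  rw [h7, h8, h.coords_red, h.coords_red, listPenalty_congr hsign, distSq_toProd, distSq_toProd,
    ← hin, ← hout, h.listPenalty_eq] at hrec
  have h0 : 0 < distSq (P.red a).toProd (center (n + m) s.mem ι) := by
    refine distSq_pos_of_sign_eq hsign ?_
    rw [distSq_toProd, ← hin]
    exact pow_pos A.rIn_pos 2
  -- the outer red point is separated from the inner one by one of the lines
  have hlt : distSq (P.red a).toProd (center (n + m) s.mem ι) <
      distSq (P.red b).toProd (center (n + m) s.mem ι) := by
    have hk := pos_iff_of_sign_eq (hsign b (by omega))
    rw [value_left (by omega), value_left (by omega), sub_pos, sub_pos, h.coords_red] at hk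
    rw [hk, distSq_toProd, distSq_toProd, ← hin, ← hout]
    exact pow_lt_pow_left₀ A.rIn_lt_rOut A.rIn_pos.le two_ne_zero
  by_cases hc : ρ 4 < 0 ∨ P.penalty A < ρ 4
  · have r4 := (hrec.pos ⟨h0, hlt, hc⟩).2.2.2.2
    exact ⟨by rw [r4]; exact P.penalty_nonneg A, r4.le⟩
  · have e := hrec.neg (fun hh => hc hh.2.2) 4 (by omega)
    rw [not_or, not_lt, not_lt] at hc
    rw [AtMost, e]
    exact hc

/-- A property kept by all candidates is kept by the search and by its inner loops. -/
theorem keeps_loops {G : (ℕ → ℝ) → Prop} {N : ℕ}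
    (hG : ∀ ι, Params n N ι → ι 7 < n → ι 8 < n → Keeps s.mem G tryCandidate 13 ι) :
    (∀ ι, Params n N ι → ι 7 < n → ι 8 < n → Keeps s.mem G (loop 5 tryCandidate) 12 ι) ∧
    (∀ ι, Params n N ι → ι 7 < n → ι 8 < n →
      Keeps s.mem G (loop 5 (loop 5 tryCandidate)) 11 ι) ∧
    (∀ ι, Params n N ι → ι 7 < n → ι 8 < n →
      Keeps s.mem G (loop 3 (loop 5 (loop 5 tryCandidate))) 10 ι) ∧
    (∀ ι, Params n N ι → ι 7 < n → ι 8 < n →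
      Keeps s.mem G (loop 3 (loop 3 (loop 5 (loop 5 tryCandidate)))) 9 ι) ∧
    (∀ ι, Params n N ι → ι 7 < n →
      Keeps s.mem G (loop 0 (loop 3 (loop 3 (loop 5 (loop 5 tryCandidate))))) 8 ι) ∧
    ∀ ι, Params n N ι → Keeps s.mem G search 7 ι := by
  have h5 : ∀ ι, Params n N ι → ι 7 < n → ι 8 < n → Keeps s.mem G (loop 5 tryCandidate) 12 ι :=
    fun ι h h7 h8 => Keeps.loop fun i _ => hG _ (h.bind (by omega)) h7 h8
  have h4 : ∀ ι, Params n N ι → ι 7 < n → ι 8 < n →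
      Keeps s.mem G (loop 5 (loop 5 tryCandidate)) 11 ι :=
    fun ι h h7 h8 => Keeps.loop fun i _ => h5 _ (h.bind (by omega)) h7 h8
  have h3 : ∀ ι, Params n N ι → ι 7 < n → ι 8 < n →
      Keeps s.mem G (loop 3 (loop 5 (loop 5 tryCandidate))) 10 ι :=
    fun ι h h7 h8 => Keeps.loop fun i _ => h4 _ (h.bind (by omega)) h7 h8
  have h2 : ∀ ι, Params n N ι → ι 7 < n → ι 8 < n →
      Keeps s.mem G (loop 3 (loop 3 (loop 5 (loop 5 tryCandidate)))) 9 ι :=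
    fun ι h h7 h8 => Keeps.loop fun i _ => h3 _ (h.bind (by omega)) h7 h8
  have h1 : ∀ ι, Params n N ι → ι 7 < n →
      Keeps s.mem G (loop 0 (loop 3 (loop 3 (loop 5 (loop 5 tryCandidate))))) 8 ι :=
    fun ι h h7 => Keeps.loop fun i hi => h2 _ (h.bind (by omega)) h7 (by
      rw [h.red] at hi
      simpa using hi)
  exact ⟨h5, h4, h3, h2, h1, fun ι h => Keeps.loop fun i hi => h1 _ (h.bind le_rfl) (by
      rw [h.red] at hi
      simpa using hi)⟩

theorem keeps_sound_search (h : Loaded P s) (hι : Params n (n + m) ι) :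
    Keeps s.mem (Sound P) search 7 ι :=
  (keeps_loops fun _ => keeps_sound_tryCandidate h).2.2.2.2.2 ι hι

theorem exists_coe_sign (σ : SignType) : ∃ e < 3, (σ : ℝ) = ((e : ℕ) : ℝ) - 1 := by
  cases σ
  · exact ⟨1, by norm_num, by simp⟩
  · exact ⟨0, by norm_num, by simp⟩
  · exact ⟨2, by norm_num, by norm_num⟩

/-- If there are two red points, the search records an optimal annulus. -/
theorem reaches_search (h : Loaded P s) (hι : Params n (n + m) ι) (hn : 2 ≤ n) (A' : Annulus) :
    Reaches s.mem (AtMost (P.penalty A')) search 7 ι := by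
  intro ρ
  obtain ⟨A, a, b, hin, hout, hle⟩ := P.exists_red_boundary hn A'
  obtain ⟨i, hi, j, hj, σ, τ, hsign⟩ := Lines.exists_sign_sample (exists_det_ne_zero
    (N := n + m) (μ := s.mem) (p := (P.red a).toProd) (q := (P.red b).toProd)) A.center.toProd
  obtain ⟨e, he, hσ⟩ := exists_coe_sign σ
  obtain ⟨f, hf, hτ⟩ := exists_coe_sign τ
  obtain ⟨k5, k4, k3, k2, k1, -⟩ :=
    keeps_loops (fun _ hι h7 h8 => keeps_atMost_tryCandidate h hι h7 h8 (P.penalty A))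
  suffices Reaches s.mem (AtMost (P.penalty A)) search 7 ι from
    ⟨(this ρ).1, (this ρ).2.trans hle⟩
  have p1 := hι.bind (q := 7) (i := a) le_rfl
  have p2 := p1.bind (q := 8) (i := b) (by omega)
  have p3 := p2.bind (q := 9) (i := i) (by omega)
  have p4 := p3.bind (q := 10) (i := j) (by omega)
  have p5 := p4.bind (q := 11) (i := e) (by omega)
  have p6 := p5.bind (q := 12) (i := f) (by omega)
  refine Reaches.loop (i := a) (by rw [hι.red]; exact a.2) ?_ fun k hk =>
    k1 _ (hι.bind le_rfl) (by rw [hι.red] at hk; simpa using hk)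
  refine Reaches.loop (i := b) (by rw [p1.red]; exact b.2) ?_ fun k hk =>
    k2 _ (p1.bind (by omega)) (by simp) (by rw [p1.red] at hk; simpa using hk)
  refine Reaches.loop (i := i) (by rw [p2.lines]; exact hi) ?_ fun k hk =>
    k3 _ (p2.bind (by omega)) (by simp) (by simp)
  refine Reaches.loop (i := j) (by rw [p3.lines]; exact hj) ?_ fun k hk =>
    k4 _ (p3.bind (by omega)) (by simp) (by simp)
  refine Reaches.loop (i := e) (by rw [p4.three]; exact he) ?_ fun k hk =>
    k5 _ (p4.bind (by omega)) (by simp) (by simp)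
  refine Reaches.loop (i := f) (by rw [p5.three]; exact hf) ?_ fun k hk =>
    keeps_atMost_tryCandidate h (p5.bind (by omega)) (by simp) (by simp) _
  refine reaches_tryCandidate h p6 (a := a) (b := b) (by simp) (by simp) hin hout ?_
  rw [hσ, hτ] at hsign
  simpa [center, h.coords_red] using hsign

/-- The size of the step taken by `isolate`. -/
noncomputable def isolatingStep (N : ℕ) (μ : ℕ → ℝ) (p : ℝ × ℝ) : ℝ :=
  (pairLines N μ p p).stepSize (2 * N + 2) p (1, 0)

theorem run_isolate {N : ℕ} {μ : ℕ → ℝ} (h : Params n N ι) (h7 : ι 7 < N) :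
    isolate.run μ 8 ι ρ 0 = (coords μ (ι 7)).1 + isolatingStep N μ (coords μ (ι 7)) ∧
    isolate.run μ 8 ι ρ 1 = (coords μ (ι 7)).2 ∧
    isolate.run μ 8 ι ρ 2 = isolatingStep N μ (coords μ (ι 7)) / 2 ∧
    isolate.run μ 8 ι ρ 3 = isolatingStep N μ (coords μ (ι 7)) := by
  simp [isolate, run, Expr.eval, Expr.eval_stepSize h, coords, isolatingStep, h.points, h.zero, h7]

/-- A short step away from a red point leads to the center of an annulus with the red point on its
outer circle that covers no other point. -/
theorem exists_isolating_annulus {P : Input 1 m} (h : Loaded P s) :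
    ∃ A : Annulus,
      A.center 0 = (coords s.mem 0).1 + isolatingStep (1 + m) s.mem (coords s.mem 0) ∧
      A.center 1 = (coords s.mem 0).2 ∧
      A.rIn = isolatingStep (1 + m) s.mem (coords s.mem 0) / 2 ∧
      A.rOut = isolatingStep (1 + m) s.mem (coords s.mem 0) ∧
      P.red 0 ∈ A.outerCircle ∧ P.penalty A = 0 := by
  have hp : coords s.mem 0 = (P.red 0).toProd := h.coords_red 0
  set t := isolatingStep (1 + m) s.mem (coords s.mem 0) with ht
  have ht0 : 0 < t := Lines.stepSize_pos _ _ _ _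
  set c : Point := !₂[P.red 0 0 + t, P.red 0 1] with hc
  have hcp : c.toProd = (P.red 0 0 + t, P.red 0 1) := by simp [hc, Point.toProd]
  have hred : dist (P.red 0) c = t := by
    rw [← sq_eq_sq₀ dist_nonneg ht0.le, ← distSq_toProd, hcp]
    simp only [distSq, Point.toProd]
    ring
  have hblue : ∀ j, t < dist (P.blue j) c := by
    intro j
    have hk : 1 + (j : ℕ) < 1 + m := by omega
    have hval := value_left (μ := s.mem) (p := coords s.mem 0) (q := coords s.mem 0)
      (c := coords s.mem 0) hk
    have hself : distSq (coords s.mem 0) (coords s.mem 0) = 0 := by simp [distSq]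
    have hdist : 0 < distSq (coords s.mem (1 + j)) (coords s.mem 0) := by
      rw [h.coords_blue, hp, distSq_toProd]
      exact pow_pos (dist_pos.2 (P.red_ne_blue 0 j).symm) 2
    rw [hself, sub_zero] at hval
    have hmove := pos_iff_of_sign_eq (Lines.sign_move_of_ne (K := 2 * (1 + m) + 2)
      (k := 1 + j) (d := (1, 0)) (by omega) (by rw [hval]; exact hdist.ne'))
    have hpt : (pairLines (1 + m) s.mem (coords s.mem 0) (coords s.mem 0)).move
        (2 * (1 + m) + 2) (coords s.mem 0) (1, 0) = c.toProd := by
      rw [hcp, Lines.move]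
      change (_ + t * 1, _ + t * 0) = _
      simp [hp, Point.toProd]
    rw [hval, hpt, value_left hk, sub_pos, h.coords_blue, hp, distSq_toProd, distSq_toProd,
      hred] at hmove
    rw [h.coords_blue, hp] at hdist
    exact lt_of_pow_lt_pow_left₀ 2 dist_nonneg (hmove.2 hdist)
  refine ⟨⟨c, t / 2, t, by positivity, by linarith⟩, ?_, ?_, rfl, rfl, hred, ?_⟩
  · simp [hc, hp, Point.toProd]
  · simp [hc, hp, Point.toProd]
  · rw [Input.penalty, Finset.sum_eq_zero, Finset.sum_eq_zero, add_zero]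
    · intro j hj
      simp only [Finset.mem_filter, Finset.mem_univ, true_and] at hj
      exact absurd hj.2 (hblue j).not_ge
    · intro i hi
      simp only [Finset.mem_filter, Finset.mem_univ, true_and] at hi
      rw [Subsingleton.elim i 0] at hi
      exact absurd ⟨by rw [hred]; linarith, hred.le⟩ hi

/-- The algorithm reports an optimal annulus. -/
theorem exists_optimal (h : Loaded P s) (hι : Params n (n + m) ι) (hn : 1 ≤ n) :
    ∃ A : Annulus, main.run s.mem 7 ι ρ 0 = A.center 0 ∧ main.run s.mem 7 ι ρ 1 = A.center 1 ∧
      main.run s.mem 7 ι ρ 2 = A.rIn ∧ main.run s.mem 7 ι ρ 3 = A.rOut ∧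
      P.IsOptimal A ∧ P.BoundaryRed A := by
  set ρ₁ := search.run s.mem 7 ι (Function.update ρ 4 (-1)) with hρ₁
  have hmain : main.run s.mem 7 ι ρ =
      (loop 0 (whenLT (.var 4) (.const 0) isolate)).run s.mem 7 ι ρ₁ := by
    simp [main, run, Expr.eval, hρ₁]
  have hsound : Sound P ρ₁ := keeps_sound_search h hι _ (Or.inl (by simp))
  rw [hmain]
  rcases hn.lt_or_eq with hn | rfl
  · have hat : ∀ A', AtMost (P.penalty A') ρ₁ := fun A' => reaches_search h hι hn A' _
    obtain hneg | ⟨A, hA⟩ := hsound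
    · have : AtMost (P.penalty ⟨0, 1, 2, by norm_num, by norm_num⟩) ρ₁ := hat _
      exact absurd hneg this.1.not_gt
    have hrun : (loop 0 (whenLT (.var 4) (.const 0) isolate)).run s.mem 7 ι ρ₁ = ρ₁ := by
      refine Keeps.loop (G := fun ρ' => ρ' = ρ₁) (fun i _ ρ' hρ' => ?_) ρ₁ rfl
      have h4 : ¬ ρ₁ 4 < 0 := (hat A).1.not_gt
      simp [run, Expr.eval, hρ', h4]
    rw [hrun]
    obtain ⟨a, b, ha, hb⟩ := hA.red
    exact ⟨A, hA.centerX, hA.centerY, hA.rIn, hA.rOut,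
      fun A' => hA.penalty ▸ (hat A').2, ⟨a, Or.inl ha⟩, fun _ => ⟨⟨a, ha⟩, b, hb⟩⟩
  · -- a single red point cannot lie on both circles, so nothing has been recorded
    have hneg : ρ₁ 4 < 0 := by
      refine hsound.resolve_right ?_
      rintro ⟨A, hA⟩
      obtain ⟨a, b, ha, hb⟩ := hA.red
      rw [Subsingleton.elim b a] at hb
      have : A.rIn = A.rOut := (Metric.mem_sphere.1 ha).symm.trans (Metric.mem_sphere.1 hb)
      exact A.rIn_lt_rOut.ne this
    obtain ⟨A, h0, h1, h2, h3, hred, hpen⟩ := exists_isolating_annulus h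
    have hrun : (loop 0 (whenLT (.var 4) (.const 0) isolate)).run s.mem 7 ι ρ₁ =
        isolate.run s.mem 8 (Function.update ι 7 0) ρ₁ := by
      simp [run, Expr.eval, hι.red, hneg]
    obtain ⟨i0, i1, i2, i3⟩ := run_isolate (μ := s.mem) (ρ := ρ₁)
      (hι.bind (q := 7) (i := 0) le_rfl) (by simp)
    rw [Function.update_self] at i0 i1 i2 i3
    rw [hrun, i0, i1, i2, i3]
    exact ⟨A, h0.symm, h1.symm, h2.symm, h3.symm, fun A' => hpen ▸ P.penalty_nonneg A',
      ⟨0, Or.inr hred⟩, fun h => absurd h (by norm_num)⟩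

end Cmd

/-! ### Running time and memory of the search -/

/-- The algorithm: compute the parameters, then run the main part. -/
def algorithm : Program :=
  .seq (.instr (.iadd 2 0 1)) (.seq (.instr (.iadd 4 2 2)) (.seq (.instr (.iconst 5 2))
    (.seq (.instr (.iadd 3 4 5)) (.seq (.instr (.iconst 5 3)) (.seq (.instr (.iconst 6 0))
      (Cmd.main.code 7))))))

namespace Cmd

theorem wf_main : main.WF 7 := by
  simp [main, search, tryCandidate, loadPair, loadLines, vertex, moveAlong, moveAcross, evaluate,
    record, isolate, WF, Expr.WF, Expr.lineA, Expr.lineB, Expr.lineC, Expr.entry, Expr.sign,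
    Expr.stepSize, Expr.ratio, Expr.penalty, Expr.sqDist, tempBase]

theorem cost_tryCandidate_le {n N : ℕ} {B : ℕ → ℕ} (hB : Params n N B) (h11 : B 11 = 3)
    (h12 : B 12 = 3) (hN : 1 ≤ N) : tryCandidate.cost 13 B ≤ 10000 * N := by
  simp only [tryCandidate, loadPair, loadLines, vertex, moveAlong, moveAcross, evaluate,
    record, cost, Expr.cost, Expr.lineA, Expr.lineB, Expr.lineC, Expr.entry, Expr.sign,
    Expr.stepSize, Expr.ratio, Expr.penalty, Expr.sqDist, h11, h12, hB.points, hB.lines]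
  omega

theorem cost_isolate_le {n N : ℕ} {B : ℕ → ℕ} (hB : Params n N B) (hN : 1 ≤ N) :
    isolate.cost 8 B ≤ 10000 * N := by
  simp only [isolate, cost, Expr.cost, Expr.lineA, Expr.lineB, Expr.lineC, Expr.entry,
    Expr.stepSize, Expr.ratio, hB.lines]
  omega

theorem loop_cost_le {E X Y b c d : ℕ} (hE : E ≤ c * X) (hb : b ≤ d * Y) (hX : 1 ≤ X)
    (hY : 1 ≤ Y) : 2 + b * (E + 3) ≤ (d * (c + 3) + 2) * (Y * X) := by
  have h1 : E + 3 ≤ (c + 3) * X := by nlinarith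
  have h2 := Nat.mul_le_mul hb h1
  have h3 := Nat.mul_le_mul hY hX
  nlinarith

theorem cost_search_le {n N : ℕ} {B : ℕ → ℕ} (hB : Params n N B) (hn : 1 ≤ n) (hN : 1 ≤ N) :
    search.cost 7 B ≤ 1500000 * (n ^ 2 * N ^ 3) := by
  have p1 := hB.bind (q := 7) (i := n) le_rfl
  have p2 := p1.bind (q := 8) (i := n) (by omega)
  have p3 := p2.bind (q := 9) (i := 2 * N + 2) (by omega)
  have p4 := p3.bind (q := 10) (i := 2 * N + 2) (by omega)
  have p5 := p4.bind (q := 11) (i := 3) (by omega)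
  have p6 := p5.bind (q := 12) (i := 3) (by omega)
  have hK : 2 * N + 2 ≤ 4 * N := by omega
  have c6 := cost_tryCandidate_le p6 (by simp) (by simp) hN
  have c5 := loop_cost_le c6 (b := 3) (d := 3) (Y := 1) (by omega) hN le_rfl
  have c4 := loop_cost_le c5 (b := 3) (d := 3) (Y := 1) (by omega) (by omega) le_rfl
  have c3 := loop_cost_le c4 hK (by omega) hN
  have c2 := loop_cost_le c3 hK (Nat.mul_pos hN (by omega)) hN
  have c1 := loop_cost_le c2 (b := n) (d := 1) (Y := n) (by omega)
    (Nat.mul_pos hN (Nat.mul_pos hN (by omega))) hn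
  have c0 := loop_cost_le c1 (b := n) (d := 1) (Y := n) (by omega)
    (Nat.mul_pos hn (Nat.mul_pos hN (Nat.mul_pos hN (by omega)))) hn
  have hpoly : n * (n * (N * (N * (1 * (1 * N))))) = n ^ 2 * N ^ 3 := by ring
  rw [hpoly] at c0
  refine le_trans (le_of_eq ?_) (c0.trans (Nat.mul_le_mul_right _ (by norm_num)))
  simp only [search, cost]
  rw [hB.red, p1.red, p2.lines, p3.lines, p4.three, p5.three]

theorem cost_main_le {n N : ℕ} {B : ℕ → ℕ} (hB : Params n N B) (hn : 1 ≤ n) (hN : 1 ≤ N) :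
    main.cost 7 B ≤ 1600000 * (n ^ 2 * N ^ 3) := by
  have hsearch := cost_search_le hB hn hN
  have hbody : (whenLT (.var 4) (.const 0) isolate).cost 8 (Function.update B 7 n) ≤
      10004 * N := by
    have := cost_isolate_le (hB.bind (q := 7) (i := n) le_rfl) hN
    simp only [cost, Expr.cost]
    omega
  have hloop := loop_cost_le hbody (b := n) (d := 1) (Y := n) (by omega) hN hn
  have hpoly : n * N ≤ n ^ 2 * N ^ 3 :=
    Nat.mul_le_mul (Nat.le_self_pow two_ne_zero n) (Nat.le_self_pow three_ne_zero N)
  have hone : 1 ≤ n ^ 2 * N ^ 3 := Nat.mul_pos (Nat.pow_pos hn) (Nat.pow_pos hN)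
  have hmain : main.cost 7 B = 2 + (search.cost 7 B + (2 + n *
      ((whenLT (.var 4) (.const 0) isolate).cost 8 (Function.update B 7 n) + 3))) := by
    simp only [main, cost, Expr.cost, hB.red]
  omega

end Cmd

/-- The algorithm halts in time and reports an optimal annulus. -/
theorem runs_algorithm {n m : ℕ} {P : Input n m} {s : State}
    (hn : 1 ≤ n) (h : Loaded P s) :
    Runs (10 * (m + n)) algorithm s
      (fun t => ∃ A, Reports t A ∧ P.IsOptimal A ∧ P.BoundaryRed A)
      (6 + 1600000 * (n ^ 2 * (m + n) ^ 3)) := by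
  set S := 10 * (m + n) with hS
  set s₁ := s.setIdx 2 (n + m)
  set s₂ := s₁.setIdx 4 (2 * (n + m))
  set s₃ := s₂.setIdx 5 2
  set s₄ := s₃.setIdx 3 (2 * (n + m) + 2)
  set s₅ := s₄.setIdx 5 3
  set s₆ := s₅.setIdx 6 0 with hs₆
  have hι : Params n (n + m) s₆.idx := by
    constructor <;> simp [s₁, s₂, s₃, s₄, s₅, s₆, h.numRed]
  have hle : ∀ i < 7, s₆.idx i ≤ S := by
    intro i hi
    interval_cases i
    · rw [hι.red]; omega
    · have : s₆.idx 1 = m := by simp [s₁, s₂, s₃, s₄, s₅, s₆, h.numBlue]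
      rw [this]; omega
    · rw [hι.points]; omega
    · rw [hι.lines]; omega
    · rw [hι.twice]; omega
    · rw [hι.three]; omega
    · rw [hι.zero]; omega
  have hB : Bounded S s₆.idx 7 s₆.idx :=
    ⟨by omega, by omega, by rw [hι.points]; omega, hle, fun _ _ => le_rfl⟩
  have hrep : Rep s.mem 7 s₆.idx s₆.reg s₆ := ⟨fun _ _ => rfl, fun _ _ => rfl, rfl⟩
  have hrun := Cmd.main.runs_code Cmd.wf_main hB hrep
  have hcost := Cmd.cost_main_le hι hn (by omega)
  rw [Nat.add_comm n m] at hcost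
  refine ((Runs.instr_seq (t := s₁) ?_ <| Runs.instr_seq (t := s₂) ?_ <|
    Runs.instr_seq (t := s₃) ?_ <| Runs.instr_seq (t := s₄) ?_ <|
    Runs.instr_seq (t := s₅) ?_ <| Runs.instr_seq (t := s₆) ?_ <| hrun).mono ?_ ?_)
  · have : n + m ≤ S := by omega
    simp [Instr.step, h.numRed, h.numBlue, this, s₁]
  · have : n + m + (n + m) ≤ S := by omega
    simp [Instr.step, this, s₁, s₂, two_mul]
  · have : 2 ≤ S := by omega
    simp [Instr.step, this, s₃]
  · have : 2 * (n + m) + 2 ≤ S := by omega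
    simp [Instr.step, this, s₂, s₃, s₄]
  · have : 3 ≤ S := by omega
    simp [Instr.step, this, s₅]
  · simp [Instr.step, s₆]
  · omega
  · intro t ht
    obtain ⟨A, h0, h1, h2, h3, hopt, hbd⟩ := Cmd.exists_optimal (ρ := s₆.reg) h hι hn
    refine ⟨A, ⟨?_, ?_, ?_, ?_⟩, hopt, hbd⟩
    · rw [ht.reg 0 (by norm_num [tempBase]), h0]
    · rw [ht.reg 1 (by norm_num [tempBase]), h1]
    · rw [ht.reg 2 (by norm_num [tempBase]), h2]
    · rw [ht.reg 3 (by norm_num [tempBase]), h3]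

end RedBlueAnnulus

theorem mainTheorem2 :
    ∃ (prog : RedBlueAnnulus.Program) (cTime cSpace : ℕ),
      ∀ (n m : ℕ) (P : RedBlueAnnulus.Input n m) (s : RedBlueAnnulus.State),
        1 ≤ n → RedBlueAnnulus.Loaded P s →
          ∃ (t : RedBlueAnnulus.State) (steps : ℕ) (A : RedBlueAnnulus.Annulus),
            RedBlueAnnulus.Exec (cSpace * (m + n)) prog s t steps ∧
              steps ≤ cTime * (n ^ 2 * (m + n) ^ 3) ∧
              RedBlueAnnulus.Reports t A ∧ P.IsOptimal A ∧ P.BoundaryRed A := by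
  refine ⟨RedBlueAnnulus.algorithm, 1600006, 10, fun n m P s hn h => ?_⟩
  obtain ⟨t, k, he, hk, A, hA⟩ := RedBlueAnnulus.runs_algorithm hn h
  refine ⟨t, k, A, he, hk.trans ?_, hA⟩
  have : 1 ≤ n ^ 2 * (m + n) ^ 3 :=
    Nat.mul_pos (Nat.pow_pos hn) (Nat.pow_pos (by omega))
  omega
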